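/- **Setting.** Let $n,k,d,h$ be integers with $k\ge 1$, $h\ge 1$ and $k+1\le d\le n-h$. Put $r=n-k$, $s=d-k+1$, $t=\lceil n/2\rceil$, $\tilde\ell=s^{t}$, $\ell=(s+h-1)\tilde\ell=(d-k+h)s^{\lceil n/2\rceil}$, and $[m]=\{0,\dots,m-1\}$. Let $\mathbb F_q$ be a finite field with $q\ge sn+1$. **Cooperative MSR codes.** An $(n,k,\ell)$ array code is an $\mathbb F_q$-linear space $\mathcal C$ of words $(C_0,\dots,C_{n-1})$, $C_i\in\mathbb F_q^\ell$, of dimension $k\ell$; it is MDS if every codeword is determined by any $k$ of its coordinates. A cooperative repair of a set $\mathcal F$ of failed nodes from a set $\mathcal H$ of helper nodes, $\mathcal F\cap\mathcal H=\emptyset$, has two rounds: first each $j\in\mathcal H$ sends to each $i\in\mathcal F$ a vector computed from $C_j$; then each $j\in\mathcal F$ sends to each other $i\in\mathcal F$ a vector computed from what $j$ received in the first round; finally each $i\in\mathcal F$ computes $C_i$ from all that it received. Its bandwidth is the total number of symbols of $\mathbb F_q$ sent. $\mathcal C$ is an $(h,d)$ cooperative MSR code if it is MDS and, for all disjoint $\mathcal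 F,\mathcal H\subset[n]$ with $|\mathcal F|=h$, $|\mathcal H|=d$, there is such a repair, valid for all codewords, with bandwidth equal to $\frac{h(d+h-1)\ell}{d-k+h}$. **Construction.** For $c=(c_0,\dots,c_{s-1})$ let $\mathbf{rot}(c)$ be the $s\times s$ matrix with $(i,j)$ entry $c_{(j-i)\bmod s}$; identify polynomials of degree less than $s$ with their coefficient vectors. For $\gamma\in\mathbb F_q$ let $g(\gamma)=\gamma(\gamma-1)(\gamma+s-1)(\gamma+s-2)$, and if $g(\gamma)\ne0$, $$F_0=x^{s-1}+\dots+x+\gamma,\qquad F_1=\frac{x^{s-1}+\dots+x-(\gamma+s-2)}{-(\gamma-1)(\gamma+s-1)},$$ $U_0=\mathbf I_s$, $U_1=\mathbf{rot}(F_1)$, $V_0=\mathbf{rot}(F_0)$, $V_1=\mathbf I_s$. Let $L^{(m)}(x)=(1,x,\dots,x^{m-1})^T$, and for $b\in\{0,1\}$ let $K_b^{(m)}(x_0,\dots,x_{s-1})$ be the $s\times s$ block matrix with $(i,j)$ block $V_b(i,j)\,L^{(m)}(x_j)$. Let $f(x_0,\dots,x_{2s-1},\gamma)=\det\big[K_0^{(2)}(x_0,\dots,x_{s-1})\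 \ K_1^{(2)}(x_s,\dots,x_{2s-1})\big]$. Call $\gamma$ and $\lambda_0,\dots,\lambda_{sn-1}\in\mathbb F_q$ *admissible* if the $\lambda_i$ are distinct and $$g(\gamma)\prod_{0\le a<\lfloor n/2\rfloor} f(\lambda_{2sa},\dots,\lambda_{2sa+2s-1},\gamma)\ne 0 .$$ Write $u\in[s^t]$ in base $s$ as $u=\sum_{z\in[t]}u_zs^z$. For $a\in[t]$ and an $s\times s$ block matrix $K$, let $\Phi_a(K)$ be the $s^t\times s^t$ block matrix whose $(u,v)$ block is $K(u_a,v_a)$ if $u_z=v_z$ for all $z\ne a$, and $\mathbf O$ otherwise. For $j\in[n]$ put $$\widetilde H_j=\Phi_{\lfloor j/2\rfloor}\big(K^{(r)}_{j\bmod 2}(\lambda_{sj},\dots,\lambda_{sj+s-1})\big),\qquad H_j=\mathbf I_{s+h-1}\otimes\widetilde H_j,$$ $$\mathcal C=\Big\{(C_0,\dots,C_{n-1}):\ C_j\in\mathbb F_q^{\ell},\ \sum_{j\in[n]}H_jC_j=\mathbf 0\Big\}.$$ **Two-step scheme.** Let $\mathcal F,\mathcal H\subset[n]$ be disjoint, $|\mathcal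 F|=h$, $|\mathcal H|=d$; for $i\in\mathcal F$ let $\hat i=|\{i'\in\mathcal F:i'<i\}|$. Let $R_{a,g}$ be the $s^{t-1}\times s^t$ matrix that selects the rows $u$ with $u_a=g$. Let $S_{a,g,z}$ be the $s\times(s+h-1)$ block matrix whose $(i,j)$ block is $R_{a,(g+i)\bmod s}$ if $j=i$ or $j=z+s$, and $\mathbf O$ otherwise. For $i\in\mathcal F$ put $$D_{i,i}^{\langle g\rangle}=S_{\lfloor i/2\rfloor,g,\hat i}\quad(g\in[s]),$$ and for $j\ne i$ put $D_{i,j}=S_{\lfloor i/2\rfloor,0,\hat i}$ if $\lfloor j/2\rfloor=\lfloor i/2\rfloor$, and $D_{i,j}=S_{\lfloor i/2\rfloor,0,\hat i}\big(\mathbf I_{s+h-1}\otimes\Phi_{\lfloor i/2\rfloor}(U_{i\bmod 2})\big)$ otherwise. Put $C_{i,i}^{\langle g\rangle}=D_{i,i}^{\langle g\rangle}C_i$ and $C_{i,j}=D_{i,j}C_j$; these are vectors of length $\tilde\ell$. *Step 1.* Each $j\in\mathcal H$ sends $C_{i,j}$ to each $i\in\mathcal F$, and $i$ computes $C_{i,i}^{\langle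 g\rangle}$, $g\in[s]$, and $C_{i,j}$, $j\in\mathcal F\setminus\{i\}$, from the received data. *Step 2.* Each $j\in\mathcal F$ sends $C_{j,i}$ to each other $i\in\mathcal F$, and $i$ computes $C_i$ from $C_{i,i}^{\langle g\rangle}$, $g\in[s]$, and the received $C_{j,i}$, $j\in\mathcal F\setminus\{i\}$. **Theorem.** Admissible $\gamma,\lambda_0,\dots,\lambda_{sn-1}$ exist in $\mathbb F_q$. For all admissible $\gamma,\lambda_0,\dots,\lambda_{sn-1}$, the code $\mathcal C$ is an $(h,d)$ cooperative MSR code with sub-packetization $\ell=(d-k+h)s^{\lceil n/2\rceil}$. Moreover, for all $\mathcal F,\mathcal H$ as above, the computations required in both steps of the two-step scheme are possible for all codewords of $\mathcal C$, so that the scheme restores all failed nodes, and its total bandwidth is $\frac{h(d+h-1)\ell}{d-k+h}$. -/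

import Mathlib

namespace CoopMSR

open scoped Matrix Kronecker

noncomputable section

/-! ## Array codes, MDS array codes and cooperative repair -/

/-- The linear array code `{(C_0, …, C_{n-1}) : H_0 C_0 + ⋯ + H_{n-1} C_{n-1} = 0}` over `F` with
parity-check sub-matrices `H_i`. Each node `C_i` is a column vector with index set `Λ`, so that the
sub-packetization is `ℓ = Fintype.card Λ`. -/
def arrayCode {F : Type*} [Field F] {n : ℕ} {P Λ : Type*} [Fintype Λ]
    (H : Fin n → Matrix P Λ F) : Submodule F (Fin n → Λ → F) :=
  LinearMap.ker (∑ i, (H i).mulVecLin ∘ₗ LinearMap.proj i)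

/-- `C` is an `(n, k, ℓ)` MDS array code: it has dimension `k ℓ` (`k` information coordinates), and
any `n - k` of its `n` coordinates can be recovered from the other `k` coordinates. -/
def IsMDSArrayCode {F : Type*} [Field F] {n : ℕ} {Λ : Type*} [Fintype Λ]
    (k : ℕ) (C : Submodule F (Fin n → Λ → F)) : Prop :=
  Module.finrank F C = k * Fintype.card Λ ∧
    ∀ T : Finset (Fin n), T.card = k →
      ∀ c ∈ C, ∀ c' ∈ C, (∀ i ∈ T, c i = c' i) → c = c'

/-- A two-round cooperative repair scheme for the failed nodes `failed` with helper nodes `helpers`.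
In the first round every helper node `j` sends to every failed node `i` a vector over `F` (with
finite index set `Idx₁ i j`) computed from its own content. In the second round every failed node
`j` sends to every other failed node `i` a vector over `F` (with finite index set `Idx₂ i j`)
computed from what `j` received in the first round. Finally every failed node computes a vector
from all that it has received. -/
structure RepairScheme (F : Type*) (Λ : Type*) {n : ℕ} (failed helpers : Finset (Fin n)) where
  Idx₁ : failed → helpers → Type
  fin₁ : ∀ i j, Fintype (Idx₁ i j)
  Idx₂ : (i : failed) → {j : failed // j ≠ i} → Type
  fin₂ : ∀ i j, Fintype (Idx₂ i j)
  send₁ : (i : failed) → (j : helpers) → (Λ → F) → (Idx₁ i j → F)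
  send₂ : (i : failed) → (j : {j : failed // j ≠ i}) →
    ((m : helpers) → Idx₁ j.1 m → F) → (Idx₂ i j → F)
  decode : (i : failed) → ((m : helpers) → Idx₁ i m → F) →
    ((j : {j : failed // j ≠ i}) → Idx₂ i j → F) → (Λ → F)

/-- The vectors that the failed node `i` receives in the first round, if the stored word is `c`. -/
def RepairScheme.received₁ {F Λ : Type*} {n : ℕ} {failed helpers : Finset (Fin n)}
    (S : RepairScheme F Λ failed helpers) (c : Fin n → Λ → F) (i : failed) :
    (m : helpers) → S.Idx₁ i m → F :=
  fun m => S.send₁ i m (c m)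

/-- The vectors that the failed node `i` receives in the second round. -/
def RepairScheme.received₂ {F Λ : Type*} {n : ℕ} {failed helpers : Finset (Fin n)}
    (S : RepairScheme F Λ failed helpers) (c : Fin n → Λ → F) (i : failed) :
    (j : {j : failed // j ≠ i}) → S.Idx₂ i j → F :=
  fun j => S.send₂ i j (S.received₁ c j.1)

/-- The scheme restores every failed node of every codeword of `C`. -/
def RepairScheme.Repairs {F Λ : Type*} [Field F] {n : ℕ} {failed helpers : Finset (Fin n)}
    (S : RepairScheme F Λ failed helpers) (C : Submodule F (Fin n → Λ → F)) : Prop :=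
  ∀ c ∈ C, ∀ i : failed, S.decode i (S.received₁ c i) (S.received₂ c i) = c i

/-- The total number of symbols of `F` transmitted in both rounds. -/
def RepairScheme.bandwidth {F Λ : Type*} {n : ℕ} {failed helpers : Finset (Fin n)}
    (S : RepairScheme F Λ failed helpers) : ℕ :=
  (∑ i, ∑ j, @Fintype.card (S.Idx₁ i j) (S.fin₁ i j)) +
    ∑ i, ∑ j, @Fintype.card (S.Idx₂ i j) (S.fin₂ i j)

/-- The optimal bandwidth `h (d + h - 1) ℓ / (d - k + h)` of the cooperative repair of `h` failed
nodes from `d` helper nodes, for an `(n, k, ℓ)` MDS array code. -/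
def optimalBandwidth (k d h l : ℕ) : ℚ :=
  (h : ℚ) * ((d : ℚ) + h - 1) * l / ((d : ℚ) - k + h)

/-- `C` is an `(h, d)` cooperative MSR code with `k` information nodes: it is an MDS array code, and
any `h` failed nodes can be recovered from any `d` other nodes with the optimal bandwidth. -/
def IsCooperativeMSR {F : Type*} [Field F] {n : ℕ} {Λ : Type*} [Fintype Λ]
    (k h d : ℕ) (C : Submodule F (Fin n → Λ → F)) : Prop :=
  IsMDSArrayCode k C ∧
    ∀ failed helpers : Finset (Fin n), failed.card = h → helpers.card = d →
      Disjoint failed helpers →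
      ∃ S : RepairScheme F Λ failed helpers,
        S.Repairs C ∧ (S.bandwidth : ℚ) = optimalBandwidth k d h (Fintype.card Λ)

/-! ## The code construction -/

/-- The index set `[s^⌈n/2⌉]`, an index `u = ∑ z, u_z s^z` being given by its base-`s` digits. -/
abbrev Digits (n s : ℕ) : Type := Fin ((n + 1) / 2) → Fin s

/-- The index set of a node of the final code: `s + h - 1` blocks of size `s^⌈n/2⌉`. -/
abbrev Sym (n s h : ℕ) : Type := Fin (s + h - 1) × Digits n s

/-- The group `⌊j/2⌋` of the node `j`. -/
def grp {n : ℕ} (j : Fin n) : Fin ((n + 1) / 2) := ⟨j / 2, by omega⟩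

/-- The index `j mod 2` of the node `j` in its group. -/
def pos {n : ℕ} (j : Fin n) : Fin 2 := ⟨j % 2, by omega⟩

/-- The circulant matrix with first row `c_0, c_1, …, c_{s-1}` (every row is the previous one
shifted cyclically to the right by one place). -/
def rot {F : Type*} {s : ℕ} (c : Fin s → F) : Matrix (Fin s) (Fin s) F :=
  Matrix.of fun i j => c (j - i)

/-- The coefficients of `F_0 = x^{s-1} + ⋯ + x + γ`. -/
def coeffF0 {F : Type*} [Field F] (s : ℕ) (γ : F) : Fin s → F :=
  fun i => if (i : ℕ) = 0 then γ else 1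

/-- The coefficients of `F_1 = (x^{s-1} + ⋯ + x - (γ + s - 2)) / (-(γ - 1)(γ + s - 1))`. -/
def coeffF1 {F : Type*} [Field F] (s : ℕ) (γ : F) : Fin s → F :=
  fun i => (if (i : ℕ) = 0 then -(γ + s - 2) else 1) / (-((γ - 1) * (γ + s - 1)))

/-- `U_0 = I_s` and `U_1 = rot(F_1)`. -/
def matU {F : Type*} [Field F] (s : ℕ) (γ : F) (b : Fin 2) : Matrix (Fin s) (Fin s) F :=
  if b = 0 then 1 else rot (coeffF1 s γ)

/-- `V_0 = rot(F_0)` and `V_1 = I_s`. -/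
def matV {F : Type*} [Field F] (s : ℕ) (γ : F) (b : Fin 2) : Matrix (Fin s) (Fin s) F :=
  if b = 0 then rot (coeffF0 s γ) else 1

/-- The column vector `L^{(t)}(x) = (1, x, …, x^{t-1})`. -/
def powVec {F : Type*} [Field F] (t : ℕ) (x : F) : Fin t → F := fun p => x ^ (p : ℕ)

/-- The `s × s` block matrix `(V_b ⊗ 1^{(t)}) ⊙ K^{(t)}(x_0, …, x_{s-1})`, whose `(i, j)` block is
the column vector `V_b(i, j) • L^{(t)}(x_j)`. -/
def kernelMatrix {F : Type*} [Field F] {s : ℕ} (t : ℕ) (γ : F) (b : Fin 2) (x : Fin s → F) :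
    Matrix (Fin s) (Fin s) (Fin t → F) :=
  Matrix.of fun i j => matV s γ b i j • powVec t (x j)

/-- `g(γ) = γ (γ - 1) (γ + s - 1) (γ + s - 2)`. -/
def gPoly {F : Type*} [Field F] (s : ℕ) (γ : F) : F :=
  γ * (γ - 1) * (γ + s - 1) * (γ + s - 2)

/-- The determinant `f` of the `2s × 2s` matrix formed by the two blocks
`(V_b ⊗ 1^{(2)}) ⊙ K^{(2)}(x_b)`, `b = 0, 1`. The columns are indexed by pairs: `(j, b)` stands for
column `j` of block `b`. (The order of the columns affects the sign only.) -/
def fDet {F : Type*} [Field F] (s : ℕ) (γ : F) (x : Fin 2 → Fin s → F) : F :=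
  Matrix.det (Matrix.of fun (u v : Fin s × Fin 2) => kernelMatrix 2 γ v.2 (x v.2) u.1 v.1 u.2)

/-- The tuple `λ_{sj}, …, λ_{sj+s-1}` that belongs to the node `j`. -/
def nodeEval {F : Type*} {n s : ℕ} (lam : Fin (n * s) → F) (j : Fin n) : Fin s → F :=
  fun x => lam (finProdFinEquiv (j, x))

/-- The requirement on `γ` and `λ_0, …, λ_{sn-1}`: the `λ_i` are distinct, and
`g(γ) ∏ f(λ_{2sa}, …, λ_{2sa+2s-1}, γ) ≠ 0`, the product being over the groups `a` of two nodes. -/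
def Admissible {F : Type*} [Field F] {n s : ℕ} (γ : F) (lam : Fin (n * s) → F) : Prop :=
  Function.Injective lam ∧
    gPoly s γ * ∏ a : Fin (n / 2),
      fDet s γ (fun b => nodeEval lam ⟨2 * (a : ℕ) + (b : ℕ), by omega⟩) ≠ 0

/-- The blow-up `Φ_{t,a}(K) = I_{s^{t-a-1}} ⊗ (I_{s^a} ⊠ K)` of an `s × s` block matrix `K` (with
blocks in `M`), where `t = ⌈n/2⌉`: in base-`s` digits it is `K` on the digit `a` and the identity on
all other digits. -/
def blowUp {M : Type*} [Zero M] {n s : ℕ} (a : Fin ((n + 1) / 2)) (K : Matrix (Fin s) (Fin s) M) :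
    Matrix (Digits n s) (Digits n s) M :=
  Matrix.of fun u v => if ∀ z, z ≠ a → u z = v z then K (u a) (v a) else 0

/-- The parity-check sub-matrix of node `j` in the intermediate code: the blow-up, at the group of
`j`, of the kernel matrix of `j`. Its blocks are column vectors of length `r`. -/
def interH {F : Type*} [Field F] {n s : ℕ} (r : ℕ) (γ : F) (lam : Fin (n * s) → F) (j : Fin n) :
    Matrix (Digits n s × Fin r) (Digits n s) F :=
  Matrix.of fun u v => blowUp (grp j) (kernelMatrix r γ (pos j) (nodeEval lam j)) u.1 v u.2

/-- `H_j = I_{s+h-1} ⊗ (parity-check sub-matrix of node j in the intermediate code)`. -/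
def parityH {F : Type*} [Field F] {n s : ℕ} (h r : ℕ) (γ : F) (lam : Fin (n * s) → F) (j : Fin n) :
    Matrix (Fin (s + h - 1) × (Digits n s × Fin r)) (Sym n s h) F :=
  (1 : Matrix (Fin (s + h - 1)) (Fin (s + h - 1)) F) ⊗ₖ interH r γ lam j

/-- The array code with parity-check sub-matrices `H_j`. -/
def code {F : Type*} [Field F] {n s : ℕ} (h r : ℕ) (γ : F) (lam : Fin (n * s) → F) :
    Submodule F (Fin n → Sym n s h → F) :=
  arrayCode (parityH h r γ lam)

/-! ## The two-step repair scheme -/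

/-- The index set of a vector of length `s · s^{⌈n/2⌉-1}`: a block index in `[s]`, and the base-`s`
digits other than the digit `a`. -/
abbrev Row (n s : ℕ) (a : Fin ((n + 1) / 2)) : Type :=
  Fin s × ({z : Fin ((n + 1) / 2) // z ≠ a} → Fin s)

/-- The row-selection matrix `R_{a,g} = I_{s^{t-a-1}} ⊗ e_g ⊗ I_{s^a}`, `t = ⌈n/2⌉`, which selects
the rows whose digit `a` is `g`. -/
def rowSel (F : Type*) [Field F] {n s : ℕ} (a : Fin ((n + 1) / 2)) (g : Fin s) :
    Matrix ({z : Fin ((n + 1) / 2) // z ≠ a} → Fin s) (Digits n s) F :=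
  Matrix.of fun w v => if v a = g ∧ ∀ z : {z // z ≠ a}, v z = w z then 1 else 0

/-- The `s × (s + h - 1)` block matrix `S_{a,g,z}`, whose `(i, j)` block is `R_{a, g ⊕ i}` (addition
modulo `s`) if `j = i` or `j = z + s`, and zero otherwise. -/
def matS (F : Type*) [Field F] {n s : ℕ} (h : ℕ) (a : Fin ((n + 1) / 2)) (g : Fin s) (z : ℕ) :
    Matrix (Row n s a) (Sym n s h) F :=
  Matrix.of fun u v =>
    if (v.1 : ℕ) = (u.1 : ℕ) ∨ (v.1 : ℕ) = z + s then rowSel F a (g + u.1) u.2 v.2 else 0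

/-- The index of the node `i` in the set `failed`, in increasing order and counted from `0`. -/
def hat {n : ℕ} (failed : Finset (Fin n)) (i : Fin n) : ℕ := (failed.filter (· < i)).card

/-- The repair matrix `S_{⌊i/2⌋,0,î} (I_{s+h-1} ⊗ Φ_{⌊i/2⌋}(U_{i mod 2}))` of the failed node `i`. -/
def repairMatrix {F : Type*} [Field F] {n s : ℕ} [NeZero s] (h : ℕ) (γ : F)
    (failed : Finset (Fin n)) (i : Fin n) : Matrix (Row n s (grp i)) (Sym n s h) F :=
  matS F h (grp i) 0 (hat failed i) *
    ((1 : Matrix (Fin (s + h - 1)) (Fin (s + h - 1)) F) ⊗ₖ blowUp (grp i) (matU s γ (pos i)))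

/-- The matrix `D_{i,i}^{⟨g⟩} = S_{⌊i/2⌋,g,î}`. -/
def matDdiag (F : Type*) [Field F] {n s : ℕ} (h : ℕ) (failed : Finset (Fin n)) (i : Fin n)
    (g : Fin s) : Matrix (Row n s (grp i)) (Sym n s h) F :=
  matS F h (grp i) g (hat failed i)

/-- The matrix `D_{i,j}`, for `j ≠ i`: it is `S_{⌊i/2⌋,0,î}` if `j` lies in the group of `i`, and the
repair matrix of `i` otherwise. -/
def matD {F : Type*} [Field F] {n s : ℕ} [NeZero s] (h : ℕ) (γ : F)
    (failed : Finset (Fin n)) (i j : Fin n) : Matrix (Row n s (grp i)) (Sym n s h) F :=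
  if grp j = grp i then matS F h (grp i) 0 (hat failed i) else repairMatrix h γ failed i

/-- What the failed node `i` computes in the first step: the vectors `C_{i,i}^{⟨g⟩}`, `g ∈ [s]`, and
the vectors `C_{i,j}`, for the other failed nodes `j`. -/
abbrev Intermediate (F : Type*) {n : ℕ} (s : ℕ) (failed : Finset (Fin n)) (i : failed) : Type _ :=
  (Fin s → Row n s (grp i.1) → F) × ({j : failed // j ≠ i} → Row n s (grp i.1) → F)

/-- The vectors `C_{i,i}^{⟨g⟩} = D_{i,i}^{⟨g⟩} C_i` and `C_{i,j} = D_{i,j} C_j` of the word `c`. -/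
def intermediate {F : Type*} [Field F] {n s : ℕ} [NeZero s] (h : ℕ) (γ : F)
    (failed : Finset (Fin n)) (c : Fin n → Sym n s h → F) (i : failed) :
    Intermediate F s failed i :=
  (fun g => matDdiag F h failed i.1 g *ᵥ c i.1, fun j => matD h γ failed i.1 j.1.1 *ᵥ c j.1.1)

/-- The two-step repair scheme. In step 1 each helper node `j` sends `C_{i,j} = D_{i,j} C_j` to each
failed node `i`, and `i` computes from the received data, by means of the map `solve i`, the vectors
`C_{i,i}^{⟨g⟩}` and `C_{i,j}` (`j ≠ i` failed). In step 2 each failed node `j` sends `C_{j,i}` to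
each other failed node `i`, and `i` computes `C_i` from its vectors `C_{i,i}^{⟨g⟩}` and the received
vectors `C_{j,i}`, by means of the map `combine i`. -/
def twoStepScheme {F : Type*} [Field F] {n s : ℕ} [NeZero s] (h : ℕ) (γ : F)
    (failed helpers : Finset (Fin n))
    (solve : (i : failed) → (helpers → Row n s (grp i.1) → F) → Intermediate F s failed i)
    (combine : (i : failed) → (Fin s → Row n s (grp i.1) → F) →
      ((j : {j : failed // j ≠ i}) → Row n s (grp j.1.1) → F) → (Sym n s h → F)) :
    RepairScheme F (Sym n s h) failed helpers where
  Idx₁ i _ := Row n s (grp i.1)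
  fin₁ _ _ := inferInstance
  Idx₂ _ j := Row n s (grp j.1.1)
  fin₂ _ _ := inferInstance
  send₁ i j C := matD h γ failed i.1 j.1 *ᵥ C
  send₂ i j data := (solve j.1 data).2 ⟨i, j.2.symm⟩
  decode i data₁ data₂ := combine i (solve i data₁).1 data₂

end

end CoopMSR

/-!
The parity-check matrix of a node acts on one digit of the index, the one that belongs to its group.
Two ideas carry the proof.

*Independence.* A set of nodes of one group whose columns are independent for polynomials of degree
less than their number `w` has a monic matrix polynomial `Q` of degree `w` that annihilates these
columns, and `Q(μ)` is invertible for every other point `μ`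
(`LocallyIndependent.exists_annihilator`). Applying `Q` to the parity-check equations removes the
group, lowers the number of available powers by `w`, and changes the contents of the other nodes by
invertible maps. By induction, independence inside each group gives independence of any `r` nodes
for the first `r` powers (`independent_of_locallyIndependent`). For the groups of the construction
local independence is the admissibility of `γ` and the `λ_i`
(`Admissible.locallyIndependent`), and the MDS property follows.

*Repair.* Folding the blocks `e` and `î + s` of a codeword gives `s` words of the intermediate code.
Taking one digit from each of them turns the parity-check equations, after multiplication by
`Φ(U)`, into those of a code with `n - 1 + s` nodes, in which the failed node `i` is replaced by `s`
virtual nodes with scalar matrices. The independence theorem applies to this code as well; since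
`n - 1 + s - d = r`, what the `d` helper nodes send determines all its nodes
(`Admissible.step_one`). In the second step the missing blocks are separated by the position `î` of
the failed nodes, the last of which has no additional block (`eq_zero_of_step_two`).

Admissible parameters exist because, for fixed distinct `λ_i`, the bad values of `γ` are roots of a
nonzero polynomial of degree less than `q` (`exists_admissible`).
-/

namespace CoopMSR

open scoped Matrix Kronecker
open Polynomial

/-! ### Local independence and independence of blown-up nodes -/

/-- The columns of the nodes `j ∈ B`, all acting on the same digit, are linearly independent: column
`m` of node `j` is the functional of evaluation at `x j m`, with coefficient `V j i m` in row `i`,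
on polynomials of degree less than `|B|`. Testing against all polynomials `P` of such degree
amounts to using the first `|B|` powers of the evaluation points. -/
def LocallyIndependent {F σ J : Type*} [Field F] [Fintype σ] (V : J → Matrix σ σ F)
    (x : J → σ → F) (B : Finset J) : Prop :=
  ∀ y : J → σ → F,
    (∀ i, ∀ P : F[X], P.degree < B.card →
      ∑ j ∈ B, ∑ m, V j i m * P.eval (x j m) * y j m = 0) →
    ∀ j ∈ B, y j = 0

theorem sum_eval_eq_zero_of_sum_pow {F κ : Type*} [Field F] (S : Finset κ) (A x : κ → F) (N : ℕ)
    (h : ∀ p < N, ∑ k ∈ S, A k * x k ^ p = 0) (P : F[X]) (hP : P.degree < N) :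
    ∑ k ∈ S, A k * P.eval (x k) = 0 := by
  have hs : P.natDegree < N ∨ P = 0 := by
    by_cases h0 : P = 0
    · exact Or.inr h0
    · exact Or.inl ((natDegree_lt_iff_degree_lt h0).2 hP)
  rcases hs with hs | rfl
  · simp_rw [eval_eq_sum_range' hs, Finset.mul_sum]
    rw [Finset.sum_comm]
    refine Finset.sum_eq_zero fun p hp => ?_
    have := h p (Finset.mem_range.1 hp)
    calc ∑ k ∈ S, A k * (P.coeff p * x k ^ p) = P.coeff p * ∑ k ∈ S, A k * x k ^ p := by
          rw [Finset.mul_sum]; exact Finset.sum_congr rfl fun k _ => by ring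
      _ = 0 := by rw [this, mul_zero]
  · simp

section Local

variable {F σ J : Type*} [Field F] [Fintype σ]
  {V : J → Matrix σ σ F} {x : J → σ → F} {B : Finset J}

/-- The square matrix of the columns in `LocallyIndependent`, in the monomial basis; the columns are
indexed by `σ × Fin |B|` through an enumeration of `B`, to make rows and columns share one index
type. -/
noncomputable def localMatrix (V : J → Matrix σ σ F) (x : J → σ → F) (B : Finset J) :
    Matrix (σ × Fin B.card) (σ × Fin B.card) F :=
  Matrix.of fun u v => V (B.equivFin.symm v.2) u.1 v.1 * x (B.equivFin.symm v.2) v.1 ^ (u.2 : ℕ)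

theorem LocallyIndependent.det_ne_zero [DecidableEq σ] (hB : LocallyIndependent V x B) :
    (localMatrix V x B).det ≠ 0 := by
  classical
  intro h0
  obtain ⟨v, hv, hMv⟩ := Matrix.exists_mulVec_eq_zero_iff.2 h0
  set y : J → σ → F := fun j m => if hj : j ∈ B then v (m, B.equivFin ⟨j, hj⟩) else 0 with hy
  apply hv
  have key := hB y (fun i P hP => ?_)
  · funext ⟨m, q⟩
    have := congrFun (key (B.equivFin.symm q) (B.equivFin.symm q).2) m
    simpa [hy] using this
  · have : ∀ p < B.card, ∑ k ∈ (Finset.univ : Finset (σ × Fin B.card)),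
        (V (B.equivFin.symm k.2) i k.1 * v k) * x (B.equivFin.symm k.2) k.1 ^ p = 0 := by
      intro p hp
      have := congrFun hMv (i, ⟨p, hp⟩)
      simp only [Matrix.mulVec, dotProduct, localMatrix, Matrix.of_apply, Pi.zero_apply] at this
      rw [← this]
      exact Finset.sum_congr rfl fun k _ => by ring
    have h2 := sum_eval_eq_zero_of_sum_pow _ _ _ _ this P hP
    rw [Fintype.sum_prod_type_right] at h2
    rw [← h2, ← Finset.sum_coe_sort B, ← B.equivFin.symm.sum_comp]
    refine Finset.sum_congr rfl fun q _ => Finset.sum_congr rfl fun m _ => ?_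
    simp only [hy, Finset.coe_mem, dif_pos, Subtype.coe_eta, Equiv.apply_symm_apply]
    ring

theorem sum_eval_mul_eq_vecMul (q : σ → F[X]) (hq : ∀ l, (q l).degree < B.card) (j : B) (m : σ) :
    ∑ l, (q l).eval (x j m) * V j l m =
      ((fun u : σ × Fin B.card => (q u.1).coeff u.2) ᵥ* localMatrix V x B) (m, B.equivFin j) := by
  simp only [Matrix.vecMul, dotProduct, localMatrix, Matrix.of_apply, Equiv.symm_apply_apply]
  rw [Fintype.sum_prod_type]
  refine Finset.sum_congr rfl fun l _ => ?_
  have hs : (q l).eval (x j m) = ∑ p : Fin B.card, (q l).coeff p * x j m ^ (p : ℕ) := by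
    rw [Fin.sum_univ_eq_sum_range (fun p => (q l).coeff p * x j m ^ p)]
    by_cases h0 : q l = 0
    · simp [h0]
    · exact eval_eq_sum_range' ((natDegree_lt_iff_degree_lt h0).2 (hq l)) _
  rw [hs, Finset.sum_mul]
  exact Finset.sum_congr rfl fun p _ => by ring

/-- Rows of polynomials of degree less than `|B|` take arbitrary values on the columns of `B`. -/
theorem LocallyIndependent.exists_interpolation [DecidableEq σ]
    (hB : LocallyIndependent V x B) (t : J → σ → F) :
    ∃ q : σ → F[X], (∀ l, (q l).degree < B.card) ∧
      ∀ j ∈ B, ∀ m, ∑ l, (q l).eval (x j m) * V j l m = t j m := by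
  have hu : IsUnit (localMatrix V x B) :=
    (Matrix.isUnit_iff_isUnit_det _).2 (isUnit_iff_ne_zero.2 hB.det_ne_zero)
  obtain ⟨w, hw⟩ := (Matrix.vecMul_surjective_iff_isUnit.2 hu)
    (fun u => t (B.equivFin.symm u.2) u.1)
  have hdeg : ∀ l, (∑ p : Fin B.card, monomial (p : ℕ) (w (l, p))).degree < (B.card : WithBot ℕ) :=
    fun l => by
      simpa only [C_mul_X_pow_eq_monomial] using degree_sum_fin_lt fun p => w (l, p)
  refine ⟨fun l => ∑ p : Fin B.card, monomial (p : ℕ) (w (l, p)), hdeg, fun j hj m => ?_⟩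
  rw [sum_eval_mul_eq_vecMul _ hdeg ⟨j, hj⟩ m]
  have : (fun u : σ × Fin B.card =>
      (∑ p : Fin B.card, monomial (p : ℕ) (w (u.1, p))).coeff u.2) = w := by
    funext ⟨l, p⟩
    simp [coeff_monomial, Fin.val_inj]
  rw [this]
  have := congrFun hw (m, B.equivFin ⟨j, hj⟩)
  simpa using this

/-- A row of polynomials of degree less than `|B|` that vanishes on all columns of `B` is zero. -/
theorem LocallyIndependent.eq_zero_of_sum_eval [DecidableEq σ]
    (hB : LocallyIndependent V x B) (q : σ → F[X])
    (hq : ∀ l, (q l).degree < B.card)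
    (h : ∀ j ∈ B, ∀ m, ∑ l, (q l).eval (x j m) * V j l m = 0) : q = 0 := by
  have h0 : (fun u : σ × Fin B.card => (q u.1).coeff u.2) = 0 := by
    refine Matrix.eq_zero_of_vecMul_eq_zero hB.det_ne_zero ?_
    funext ⟨m, p⟩
    have := sum_eval_mul_eq_vecMul (V := V) (x := x) q hq (B.equivFin.symm p) m
    rw [h _ (B.equivFin.symm p).2 m, Equiv.apply_symm_apply] at this
    exact this.symm
  funext l
  ext p
  by_cases hp : p < B.card
  · exact congrFun h0 (l, ⟨p, hp⟩)
  · exact coeff_eq_zero_of_degree_lt ((hq l).trans_le (by exact_mod_cast not_lt.1 hp))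

/-- A matrix polynomial `Q = X ^ |B| + ⋯` that annihilates all columns of `B`. It is invertible away
from the evaluation points of `B`: if `y Q(μ) = 0`, then `y Q = (X - μ) R`, where the row `R` has
degree less than `|B|` and vanishes on the columns of `B`, so that `R = 0`, and the leading
coefficient `y` of `y Q` is zero. -/
theorem LocallyIndependent.exists_annihilator [DecidableEq σ] (hB : LocallyIndependent V x B) :
    ∃ Q : Matrix σ σ F[X], (∀ i l, (Q i l).degree ≤ B.card) ∧
      (∀ j ∈ B, ∀ i m, ∑ l, (Q i l).eval (x j m) * V j l m = 0) ∧
      ∀ μ, (∀ j ∈ B, ∀ m, x j m ≠ μ) → (Q.map (eval μ)).det ≠ 0 := by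
  choose q hq hqe using fun i => hB.exists_interpolation
    (fun j m => - (V j i m * x j m ^ B.card))
  set Q : Matrix σ σ F[X] := Matrix.of fun i l => (if i = l then X ^ B.card else 0) + q i l with hQ
  have hdeg : ∀ i l, (Q i l).degree ≤ B.card := by
    intro i l
    have h1 : (if i = l then X ^ B.card else 0 : F[X]).degree ≤ B.card := by
      split_ifs <;> simp
    exact (degree_add_le _ _).trans (max_le h1 (hq i l).le)
  have hkill : ∀ j ∈ B, ∀ i m, ∑ l, (Q i l).eval (x j m) * V j l m = 0 := by
    intro j hj i m
    simp only [hQ, Matrix.of_apply, eval_add, add_mul, Finset.sum_add_distrib]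
    rw [hqe i j hj m]
    have : ∀ l, eval (x j m) (if i = l then X ^ B.card else 0) * V j l m =
        if i = l then x j m ^ B.card * V j i m else 0 := by
      intro l
      split_ifs with h
      · subst h; simp
      · simp
    simp only [this, Finset.sum_ite_eq, Finset.mem_univ, if_true]
    ring
  refine ⟨Q, hdeg, hkill, fun μ hμ h0 => ?_⟩
  obtain ⟨y, hy, hyQ⟩ := Matrix.exists_vecMul_eq_zero_iff.2 h0
  set P : σ → F[X] := fun l => ∑ i, C (y i) * Q i l with hP
  have hroot : ∀ l, (P l).IsRoot μ := by
    intro l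
    have := congrFun hyQ l
    simpa [Matrix.vecMul, dotProduct, hP, eval_finsetSum] using this
  choose R hR using fun l => dvd_iff_isRoot.2 (hroot l)
  have hPdeg : ∀ l, (P l).degree ≤ B.card := by
    intro l
    refine (degree_sum_le _ _).trans (Finset.sup_le fun i _ => ?_)
    refine (degree_mul_le _ _).trans ?_
    calc (C (y i)).degree + (Q i l).degree ≤ 0 + (B.card : WithBot ℕ) :=
          add_le_add degree_C_le (hdeg i l)
      _ = B.card := zero_add _
  have hRdeg : ∀ l, (R l).degree < B.card := by
    intro l
    by_cases hR0 : R l = 0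
    · rw [hR0, degree_zero]; exact WithBot.bot_lt_coe _
    have := hPdeg l
    rw [hR l, degree_mul, degree_X_sub_C, degree_eq_natDegree hR0] at this
    rw [degree_eq_natDegree hR0]
    have h' : 1 + (R l).natDegree ≤ B.card := by exact_mod_cast this
    exact_mod_cast (by omega : (R l).natDegree < B.card)
  have hR0 : R = 0 := by
    refine hB.eq_zero_of_sum_eval R hRdeg fun j hj m => ?_
    have h1 : ∑ l, (P l).eval (x j m) * V j l m = 0 := by
      simp only [hP, eval_finsetSum, eval_mul, eval_C, Finset.sum_mul]
      rw [Finset.sum_comm]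
      refine Finset.sum_eq_zero fun i _ => ?_
      simp only [mul_assoc]
      rw [← Finset.mul_sum, hkill j hj i m, mul_zero]
    simp only [hR, eval_mul, eval_sub, eval_X, eval_C, mul_assoc] at h1
    rw [← Finset.mul_sum] at h1
    exact (mul_eq_zero.1 h1).resolve_left (sub_ne_zero.2 (hμ j hj m))
  apply hy
  funext l
  have hc : (P l).coeff B.card = y l := by
    simp only [hP, finsetSum_coeff, coeff_C_mul, hQ, Matrix.of_apply, coeff_add]
    have : ∀ i, y i * ((if i = l then X ^ B.card else 0 : F[X]).coeff B.card +
        (q i l).coeff B.card) = if i = l then y i else 0 := by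
      intro i
      rw [coeff_eq_zero_of_degree_lt (hq i l)]
      split_ifs <;> simp
    simp [this]
  rw [← hc, hR l, hR0]
  simp

end Local

/-- Nodes acting on different digits: if the nodes of `T` in each group are locally independent, and
nodes of different groups have different evaluation points, then the blown-up parity-check columns
of all the nodes in `T`, restricted to the first `|T|` powers, are linearly independent.

In the induction step one group `a`, with the set `B` of nodes in `T`, is removed by applying the
annihilator `Q` of `B` on the digit `a`. It commutes with the nodes of the other groups, which only
have their contents multiplied by the invertible matrices `Q(x)`, and it costs `|B|` degrees. -/
theorem independent_of_locallyIndependent {F σ J ι : Type*} [Field F] [Fintype σ] [DecidableEq σ]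
    [DecidableEq ι] (grp : J → ι) (V : J → Matrix σ σ F) (x : J → σ → F) (T : Finset J)
    (hV : ∀ a, LocallyIndependent V x (T.filter fun j => grp j = a))
    (hx : ∀ j ∈ T, ∀ j' ∈ T, grp j ≠ grp j' → ∀ m m', x j m ≠ x j' m')
    (c : J → (ι → σ) → F)
    (h : ∀ u, ∀ P : F[X], P.degree < T.card → ∑ j ∈ T, ∑ m,
      V j (u (grp j)) m * P.eval (x j m) * c j (Function.update u (grp j) m) = 0) :
    ∀ j ∈ T, c j = 0 := by
  classical
  induction T using Finset.strongInduction generalizing c with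
  | H T ih =>
  rcases T.eq_empty_or_nonempty with rfl | ⟨j₀, hj₀⟩
  · simp
  set a := grp j₀ with ha
  set B := T.filter fun j => grp j = a with hBdef
  set T' := T.filter fun j => ¬ grp j = a with hT'
  have hcard : B.card + T'.card = T.card := Finset.card_filter_add_card_filter_not _
  have hsub : T' ⊂ T := by
    refine Finset.filter_ssubset.2 ⟨j₀, hj₀, by simp [ha]⟩
  obtain ⟨Q, hQdeg, hQkill, hQdet⟩ := (hV a).exists_annihilator
  have hsplit : ∀ f : J → F, ∑ j ∈ T, f j = ∑ j ∈ B, f j + ∑ j ∈ T', f j :=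
    fun f => (Finset.sum_filter_add_sum_filter_not T _ f).symm
  have hT'0 : ∀ j ∈ T', c j = 0 := by
    -- the contents multiplied by `Q`, evaluated at the points of the node `j`, satisfy the
    -- equations for the smaller set `T'`
    have hc' := ih T' hsub (fun a' => ?_) (fun j hj j' hj' => hx j (hsub.1 hj) j' (hsub.1 hj'))
      (fun j v => ∑ l, (Q (v a) l).eval (x j (v (grp j))) * c j (Function.update v a l))
      (fun u P hP => ?_)
    · intro j hj
      have hjT := (Finset.mem_filter.1 hj).1
      have hja := (Finset.mem_filter.1 hj).2
      funext v
      have hdet := hQdet (x j (v (grp j))) (fun j' hj' m => hx j' (Finset.mem_filter.1 hj').1 j hjT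
        (by rw [(Finset.mem_filter.1 hj').2]; exact Ne.symm hja) _ _)
      have hz := Matrix.eq_zero_of_mulVec_eq_zero hdet
        (v := fun l => c j (Function.update v a l)) (by
          funext i
          have := congrFun (hc' j hj) (Function.update v a i)
          simpa [Matrix.mulVec, dotProduct, Function.update_of_ne hja] using this)
      simpa using congrFun hz (v a)
    · by_cases haa : a' = a
      · have : T'.filter (fun j => grp j = a') = ∅ := by
          rw [hT', Finset.filter_filter, haa]; simp
        rw [this]
        intro y _ j hj
        simp at hj
      · have : T'.filter (fun j => grp j = a') = T.filter (fun j => grp j = a') := by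
          ext j
          simp only [hT', Finset.mem_filter]
          constructor
          · rintro ⟨⟨h1, _⟩, h3⟩; exact ⟨h1, h3⟩
          · rintro ⟨h1, h3⟩; exact ⟨⟨h1, by rw [h3]; exact haa⟩, h3⟩
        rw [this]
        exact hV a'
    · have hPQ : ∀ l, (P * Q (u a) l).degree < T.card := by
        intro l
        by_cases hP0 : P = 0
        · simp only [hP0, zero_mul, degree_zero]; exact WithBot.bot_lt_coe _
        by_cases hQ0 : Q (u a) l = 0
        · simp only [hQ0, mul_zero, degree_zero]; exact WithBot.bot_lt_coe _
        have h1 := hQdeg (u a) l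
        rw [degree_mul]
        rw [degree_eq_natDegree hP0] at hP ⊢
        rw [degree_eq_natDegree hQ0] at h1 ⊢
        have h1' : (Q (u a) l).natDegree ≤ B.card := by exact_mod_cast h1
        have h2' : P.natDegree < T'.card := by exact_mod_cast hP
        exact_mod_cast (by omega : P.natDegree + (Q (u a) l).natDegree < T.card)
      have hsum : ∑ l, ∑ j ∈ T, ∑ m, V j (Function.update u a l (grp j)) m *
          (P * Q (u a) l).eval (x j m) *
            c j (Function.update (Function.update u a l) (grp j) m) = 0 :=
        Finset.sum_eq_zero fun l _ => h (Function.update u a l) _ (hPQ l)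
      rw [Finset.sum_comm, hsplit] at hsum
      have hB0 : ∑ j ∈ B, ∑ l, ∑ m, V j (Function.update u a l (grp j)) m *
          (P * Q (u a) l).eval (x j m) *
            c j (Function.update (Function.update u a l) (grp j) m) = 0 := by
        refine Finset.sum_eq_zero fun j hj => ?_
        rw [Finset.sum_comm]
        refine Finset.sum_eq_zero fun m _ => ?_
        have hja := (Finset.mem_filter.1 hj).2
        rw [hja]
        simp only [Function.update_self, Function.update_idem, eval_mul]
        calc _ = P.eval (x j m) * c j (Function.update u a m) *
              ∑ l, (Q (u a) l).eval (x j m) * V j l m := by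
              rw [Finset.mul_sum]; exact Finset.sum_congr rfl fun l _ => by ring
          _ = 0 := by rw [hQkill j hj, mul_zero]
      rw [hB0, zero_add] at hsum
      rw [← hsum]
      refine Finset.sum_congr rfl fun j hj => ?_
      have hja := (Finset.mem_filter.1 hj).2
      rw [Finset.sum_comm]
      refine Finset.sum_congr rfl fun m _ => ?_
      rw [Finset.mul_sum]
      refine Finset.sum_congr rfl fun l _ => ?_
      rw [Function.update_of_ne hja, Function.update_of_ne (Ne.symm hja), Function.update_self,
        Function.update_comm hja, eval_mul]
      ring
  intro j hj
  by_cases hja : grp j = a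
  · funext v
    have hy := hV a (fun j m => c j (Function.update v a m)) (fun i P hP => ?_) j
      (Finset.mem_filter.2 ⟨hj, hja⟩)
    · simpa using congrFun hy (v a)
    · have h1 := h (Function.update v a i) P (hP.trans_le (by
        exact_mod_cast Finset.card_filter_le _ _))
      rw [hsplit] at h1
      have h2 : ∑ j ∈ T', ∑ m, V j (Function.update v a i (grp j)) m * P.eval (x j m) *
          c j (Function.update (Function.update v a i) (grp j) m) = 0 :=
        Finset.sum_eq_zero fun j hj => by simp [hT'0 j hj]
      rw [h2, add_zero] at h1
      rw [← h1]
      refine Finset.sum_congr rfl fun j hj => ?_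
      rw [(Finset.mem_filter.1 hj).2]
      simp
  · exact hT'0 j (Finset.mem_filter.2 ⟨hj, hja⟩)

/-! ### The kernel matrices of the construction -/

theorem locallyIndependent_empty {F σ J : Type*} [Field F] [Fintype σ] (V : J → Matrix σ σ F)
    (x : J → σ → F) : LocallyIndependent V x ∅ := by
  intro y _ j hj
  simp at hj

theorem locallyIndependent_singleton {F σ J : Type*} [Field F] [Fintype σ] [DecidableEq σ]
    {V : J → Matrix σ σ F} (x : J → σ → F) {j : J} (hV : (V j).det ≠ 0) :
    LocallyIndependent V x {j} := by
  intro y hy j' hj'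
  rw [Finset.mem_singleton] at hj'
  subst hj'
  refine Matrix.eq_zero_of_mulVec_eq_zero hV ?_
  funext i
  have := hy i 1 (by simp)
  simpa [Matrix.mulVec, dotProduct] using this

/-- Nodes with scalar matrices: the columns form one Vandermonde matrix for each digit `m`. -/
theorem locallyIndependent_of_diagonal {F σ J : Type*} [Field F] [Fintype σ] [DecidableEq σ]
    {V : J → Matrix σ σ F} {x : J → σ → F} {B : Finset J} (e : J → F) (he : ∀ j ∈ B, e j ≠ 0)
    (hV : ∀ j ∈ B, V j = e j • (1 : Matrix σ σ F)) (hx : ∀ m, Set.InjOn (fun j => x j m) B) :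
    LocallyIndependent V x B := by
  classical
  intro y hy j hj
  funext m
  -- the polynomial vanishing at the evaluation points of all nodes of `B` except `j` isolates
  -- `y j m`
  set P : F[X] := ∏ j' ∈ B.erase j, (X - C (x j' m)) with hP
  have hdeg : P.degree < B.card := by
    rw [hP, degree_prod_of_monic _ _ fun _ _ => monic_X_sub_C _]
    simp only [degree_X_sub_C, Finset.sum_const, nsmul_eq_mul, mul_one]
    exact_mod_cast Finset.card_erase_lt_of_mem hj
  have h := hy m P hdeg
  rw [Finset.sum_eq_single_of_mem j hj] at h
  · rw [Finset.sum_eq_single m] at h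
    · rw [hV j hj] at h
      have hPj : P.eval (x j m) ≠ 0 := by
        rw [hP, eval_prod]
        refine Finset.prod_ne_zero_iff.2 fun j' hj' => ?_
        rw [eval_sub, eval_X, eval_C, sub_ne_zero]
        intro hxx
        exact (Finset.mem_erase.1 hj').1 (hx m (Finset.mem_erase.1 hj').2 hj hxx.symm)
      simpa [he j hj, hPj] using h
    · intro m' _ hm
      rw [hV j hj, Matrix.smul_apply, Matrix.one_apply_ne hm.symm]; simp
    · simp
  · intro j' hj' hne
    refine Finset.sum_eq_zero fun m' _ => ?_
    rw [hV j' hj', Matrix.smul_apply]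
    by_cases hm : m = m'
    · subst hm
      have : P.eval (x j' m) = 0 := by
        rw [hP, eval_prod]
        exact Finset.prod_eq_zero (Finset.mem_erase.2 ⟨hne, hj'⟩) (by simp)
      simp [this]
    · simp [Matrix.one_apply_ne hm]

theorem LocallyIndependent.map {F σ J J' : Type*} [Field F] [Fintype σ] {V : J → Matrix σ σ F}
    {x : J → σ → F} {B : Finset J} (hB : LocallyIndependent V x B) (e : J ↪ J')
    {V' : J' → Matrix σ σ F} {x' : J' → σ → F} (hV : ∀ j ∈ B, V' (e j) = V j)
    (hx : ∀ j ∈ B, x' (e j) = x j) : LocallyIndependent V' x' (B.map e) := by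
  intro y hy j' hj'
  obtain ⟨j, hj, rfl⟩ := Finset.mem_map.1 hj'
  refine hB (fun j => y (e j)) (fun i P hP => ?_) j hj
  have := hy i P (by rwa [Finset.card_map])
  rw [Finset.sum_map] at this
  rw [← this]
  exact Finset.sum_congr rfl fun j hj => by rw [hV j hj, hx j hj]

theorem rot_mul_rot {F : Type*} [Field F] {s : ℕ} [NeZero s] {γ : F} (hγ : gPoly s γ ≠ 0) :
    rot (coeffF1 s γ) * rot (coeffF0 s γ) = 1 := by
  have h1 : γ - 1 ≠ 0 := fun h => hγ (by simp [gPoly, h])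
  have h2 : γ + s - 1 ≠ 0 := fun h => hγ (by simp [gPoly, h])
  have hd : -((γ - 1) * (γ + s - 1)) ≠ 0 := neg_ne_zero.2 (mul_ne_zero h1 h2)
  have e0 : (rot (coeffF0 s γ) : Matrix (Fin s) (Fin s) F) =
      (γ - 1) • 1 + Matrix.of fun _ _ => 1 := by
    ext i j
    by_cases h : i = j
    · subst h; simp [rot, coeffF0]
    · have h' : j - i ≠ 0 := sub_ne_zero.2 (Ne.symm h)
      simp [rot, coeffF0, h', h]
  have e1 : (rot (coeffF1 s γ) : Matrix (Fin s) (Fin s) F) =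
      (-((γ - 1) * (γ + s - 1)))⁻¹ • (-(γ + s - 1) • 1 + Matrix.of fun _ _ => 1) := by
    ext i j
    by_cases h : i = j
    · subst h; simp [rot, coeffF1]; field_simp; ring
    · have h' : j - i ≠ 0 := sub_ne_zero.2 (Ne.symm h)
      simp [rot, coeffF1, h', h]
  have hJ : (Matrix.of fun _ _ => 1 : Matrix (Fin s) (Fin s) F) * (Matrix.of fun _ _ => 1) =
      (s : F) • Matrix.of fun _ _ => 1 := by
    ext i j; simp [Matrix.mul_apply]
  rw [e0, e1, Matrix.smul_mul, inv_smul_eq_iff₀ hd]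
  simp only [add_mul, mul_add, Matrix.smul_mul, Matrix.mul_smul, Matrix.one_mul, Matrix.mul_one, hJ]
  ext i j
  simp only [Matrix.add_apply, Matrix.smul_apply, Matrix.of_apply, smul_eq_mul]
  ring

theorem det_matV_ne_zero {F : Type*} [Field F] {s : ℕ} [NeZero s] {γ : F} (hγ : gPoly s γ ≠ 0)
    (b : Fin 2) : (matV s γ b).det ≠ 0 := by
  unfold matV
  split_ifs
  · exact Matrix.det_ne_zero_of_left_inverse (rot_mul_rot hγ)
  · simp

theorem det_matU_ne_zero {F : Type*} [Field F] {s : ℕ} [NeZero s] {γ : F} (hγ : gPoly s γ ≠ 0)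
    (b : Fin 2) : (matU s γ b).det ≠ 0 := by
  unfold matU
  split_ifs
  · simp
  · exact Matrix.det_ne_zero_of_right_inverse (rot_mul_rot hγ)

theorem matU_mul_matV_of_ne {F : Type*} [Field F] {s : ℕ} [NeZero s] {γ : F}
    (hγ : gPoly s γ ≠ 0) {b b' : Fin 2} (h : b ≠ b') : matU s γ b * matV s γ b' = 1 := by
  unfold matU matV
  by_cases hb : b = 0
  · subst hb
    rw [if_pos rfl, if_neg (Ne.symm h), one_mul]
  · have hb' : b' = 0 := by omega
    rw [if_neg hb, if_pos hb', rot_mul_rot hγ]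

/-- `U_b V_b` is the circulant matrix of `F_b`, and no coefficient of `F_b` vanishes. In the repair
of a node, its `s` virtual nodes are weighted by these coefficients. -/
theorem exists_matU_mul_matV_eq_rot {F : Type*} [Field F] {s : ℕ} [NeZero s] {γ : F}
    (hγ : gPoly s γ ≠ 0) (b : Fin 2) :
    ∃ e : Fin s → F, (∀ g, e g ≠ 0) ∧ matU s γ b * matV s γ b = rot e := by
  have h0 : γ ≠ 0 := fun h => hγ (by simp [gPoly, h])
  have h1 : γ - 1 ≠ 0 := fun h => hγ (by simp [gPoly, h])
  have h2 : γ + s - 1 ≠ 0 := fun h => hγ (by simp [gPoly, h])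
  have h3 : γ + s - 2 ≠ 0 := fun h => hγ (by simp [gPoly, h])
  unfold matU matV
  by_cases hb : b = 0
  · refine ⟨coeffF0 s γ, fun g => ?_, by simp [hb]⟩
    unfold coeffF0
    split_ifs
    exacts [h0, one_ne_zero]
  · refine ⟨coeffF1 s γ, fun g => ?_, by simp [hb]⟩
    unfold coeffF1
    refine div_ne_zero ?_ (neg_ne_zero.2 (mul_ne_zero h1 h2))
    split_ifs
    exacts [neg_ne_zero.2 h3, one_ne_zero]

theorem locallyIndependent_pair {F J : Type*} [Field F] [DecidableEq J] {s : ℕ} {γ : F}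
    {V : J → Matrix (Fin s) (Fin s) F} {x : J → Fin s → F} (j : Fin 2 → J) (hj : j 0 ≠ j 1)
    (hV : ∀ b, V (j b) = matV s γ b) (hf : fDet s γ (fun b => x (j b)) ≠ 0) :
    LocallyIndependent V x {j 0, j 1} := by
  intro y hy
  have hz := Matrix.eq_zero_of_mulVec_eq_zero hf (v := fun v => y (j v.2) v.1) (by
    funext ⟨i, p⟩
    have := hy i (X ^ (p : ℕ)) (by
      rw [degree_X_pow, Finset.card_pair hj]; exact_mod_cast p.2)
    rw [Finset.sum_pair hj] at this
    simp only [Matrix.mulVec, dotProduct, Matrix.of_apply, kernelMatrix, Pi.zero_apply,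
      Pi.smul_apply, powVec, smul_eq_mul]
    rw [Fintype.sum_prod_type_right, Fin.sum_univ_two]
    simpa [hV] using this)
  have hb : ∀ b, y (j b) = 0 := fun b => by
    funext m
    exact congrFun hz (m, b)
  intro j' hj'
  rcases Finset.mem_insert.1 hj' with rfl | h
  · exact hb 0
  · rw [Finset.mem_singleton.1 h]; exact hb 1

theorem Admissible.gPoly_ne_zero {F : Type*} [Field F] {n s : ℕ} {γ : F} {lam : Fin (n * s) → F}
    (h : Admissible γ lam) : gPoly s γ ≠ 0 := left_ne_zero_of_mul h.2

theorem Admissible.nodeEval_inj {F : Type*} [Field F] {n s : ℕ} {γ : F} {lam : Fin (n * s) → F}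
    (h : Admissible γ lam) {j j' : Fin n} {m m' : Fin s}
    (he : nodeEval lam j m = nodeEval lam j' m') : j = j' ∧ m = m' := by
  have := finProdFinEquiv.injective (h.1 he)
  simpa using this

theorem eq_of_grp_eq_of_pos_eq {n : ℕ} {j j' : Fin n} (hg : grp j = grp j') (hp : pos j = pos j') :
    j = j' := by
  simp only [grp, pos, Fin.mk.injEq] at hg hp
  ext
  omega

/-- A group has at most two nodes: two are independent as `fDet` does not vanish, and one as `V_b`
is invertible. -/
theorem Admissible.locallyIndependent {F : Type*} [Field F] {n s : ℕ} [NeZero s] {γ : F}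
    {lam : Fin (n * s) → F} (h : Admissible γ lam) (B : Finset (Fin n)) (a : Fin ((n + 1) / 2))
    (hB : ∀ j ∈ B, grp j = a) :
    LocallyIndependent (fun j => matV s γ (pos j)) (nodeEval lam) B := by
  rcases B.eq_empty_or_nonempty with rfl | ⟨j₀, hj₀⟩
  · exact locallyIndependent_empty _ _
  by_cases h1 : ∀ j ∈ B, j = j₀
  · have : B = {j₀} := Finset.eq_singleton_iff_unique_mem.2 ⟨hj₀, h1⟩
    rw [this]
    exact locallyIndependent_singleton _ (det_matV_ne_zero h.gPoly_ne_zero _)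
  push Not at h1
  obtain ⟨j₁, hj₁, hne⟩ := h1
  have hp : pos j₁ ≠ pos j₀ := fun hp =>
    hne (eq_of_grp_eq_of_pos_eq ((hB _ hj₁).trans (hB _ hj₀).symm) hp)
  have ha0 := congrArg Fin.val (hB _ hj₀)
  have ha1 := congrArg Fin.val (hB _ hj₁)
  have hp' : (j₁ : ℕ) % 2 ≠ j₀ % 2 := fun hh => hp (Fin.ext hh)
  simp only [grp] at ha0 ha1
  have hlt : (a : ℕ) < n / 2 := by
    have := j₀.2
    have := j₁.2
    omega
  have hb : ∀ b : Fin 2, 2 * (a : ℕ) + b < n := fun b => by omega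
  set e : Fin 2 → Fin n := fun b => ⟨2 * (a : ℕ) + b, hb b⟩ with he
  have hBe : B = {e 0, e 1} := by
    ext j
    simp only [Finset.mem_insert, Finset.mem_singleton, he, Fin.ext_iff]
    constructor
    · intro hj
      have := congrArg Fin.val (hB _ hj)
      simp only [grp] at this
      simp only [Fin.val_zero, Fin.val_one]
      omega
    · simp only [Fin.val_zero, Fin.val_one]
      intro hj
      have : j = j₀ ∨ j = j₁ := by
        simp only [Fin.ext_iff]
        omega
      rcases this with rfl | rfl <;> assumption
  rw [hBe]
  refine locallyIndependent_pair (γ := γ) e (by simp [he]) (fun b => ?_) ?_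
  · have : pos (e b) = b := by
      simp only [pos, he, Fin.ext_iff]
      omega
    rw [this]
  · have := Finset.prod_ne_zero_iff.1 (right_ne_zero_of_mul h.2) ⟨a, hlt⟩ (Finset.mem_univ _)
    exact this

/-- For fixed evaluation points, `f` can vanish at `γ` only if `det (V_0(i, j) (x_j - y_i))` does,
where `x` and `y` are the points of the two nodes; this is a polynomial of degree `s` in `γ`, with
leading coefficient `∏ (x_i - y_i)`. -/
theorem exists_polynomial_fDet_ne_zero {F : Type*} [Field F] {s : ℕ} [NeZero s]
    (x : Fin 2 → Fin s → F) (hx : ∀ i, x 0 i ≠ x 1 i) :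
    ∃ P : F[X], P ≠ 0 ∧ P.natDegree ≤ s ∧ ∀ γ, P.eval γ ≠ 0 → fDet s γ x ≠ 0 := by
  set D : Matrix (Fin s) (Fin s) F := Matrix.diagonal fun i => x 0 i - x 1 i with hD
  set N : Matrix (Fin s) (Fin s) F :=
    Matrix.of fun i j => if i = j then 0 else x 0 j - x 1 i with hN
  refine ⟨((X : F[X]) • D.map C + N.map C).det, fun h0 => ?_, ?_, fun γ hγ hf => hγ ?_⟩
  · have := coeff_det_X_add_C_card D N
    rw [h0, coeff_zero, hD, Matrix.det_diagonal] at this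
    exact Finset.prod_ne_zero_iff.2 (fun i _ => sub_ne_zero.2 (hx i)) this.symm
  · simpa using natDegree_det_X_add_C_le D N
  · obtain ⟨v, hv, hMv⟩ := Matrix.exists_mulVec_eq_zero_iff.2 hf
    have heq : ∀ i (p : Fin 2), ∑ m, matV s γ 0 i m * x 0 m ^ (p : ℕ) * v (m, 0) +
        x 1 i ^ (p : ℕ) * v (i, 1) = 0 := by
      intro i p
      have := congrFun hMv (i, p)
      simp only [Matrix.mulVec, dotProduct, Matrix.of_apply, kernelMatrix, Pi.zero_apply,
        Pi.smul_apply, powVec, smul_eq_mul] at this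
      rw [Fintype.sum_prod_type_right, Fin.sum_univ_two] at this
      simpa [matV, Matrix.one_apply] using this
    have hM : (γ • D + N).det = 0 := by
      refine Matrix.exists_mulVec_eq_zero_iff.1 ⟨fun m => v (m, 0), fun hv0 => hv ?_, ?_⟩
      · have hv0' : ∀ m, v (m, 0) = 0 := congrFun hv0
        funext ⟨m, b⟩
        have h1 := heq m 0
        simp only [hv0', mul_zero, Finset.sum_const_zero, zero_add] at h1
        fin_cases b
        · exact hv0' m
        · simpa using h1
      · funext i
        have h0 := heq i 0
        have h1 := heq i 1
        have : (γ • D + N).mulVec (fun m => v (m, 0)) i =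
            (∑ m, matV s γ 0 i m * x 0 m ^ ((1 : Fin 2) : ℕ) * v (m, 0) +
              x 1 i ^ ((1 : Fin 2) : ℕ) * v (i, 1)) -
            x 1 i * (∑ m, matV s γ 0 i m * x 0 m ^ ((0 : Fin 2) : ℕ) * v (m, 0) +
              x 1 i ^ ((0 : Fin 2) : ℕ) * v (i, 1)) := by
          simp only [Fin.val_zero, Fin.val_one, pow_zero, pow_one, mul_add, Finset.mul_sum]
          rw [add_sub_add_comm]
          rw [← Finset.sum_sub_distrib]
          simp only [Matrix.mulVec, dotProduct]
          rw [show x 1 i * v (i, 1) - x 1 i * (1 * v (i, 1)) = 0 by ring, add_zero]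
          refine Finset.sum_congr rfl fun m _ => ?_
          by_cases h : i = m
          · subst h
            simp [hD, hN, matV, rot, coeffF0]
            ring
          · have h' : m - i ≠ 0 := sub_ne_zero.2 (Ne.symm h)
            simp [hD, hN, matV, rot, coeffF0, h, h']
            ring
        rw [this, h0, h1]
        simp
    rw [← coe_evalRingHom, RingHom.map_det, ← hM]
    congr 1
    ext i j
    simp [mul_comm (D i j)]

/-- Any distinct `λ_i` extend to an admissible choice: the values of `γ` to be avoided are the roots
of a nonzero polynomial of degree at most `4 + s ⌊n/2⌋ ≤ s n < q`. -/
theorem exists_admissible {F : Type*} [Field F] [Fintype F] {n s : ℕ} (hn : 3 ≤ n) (hs : 2 ≤ s)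
    (hq : s * n + 1 ≤ Fintype.card F) :
    ∃ (γ : F) (lam : Fin (n * s) → F), Admissible γ lam := by
  have : NeZero s := ⟨by omega⟩
  obtain ⟨lam⟩ : Nonempty (Fin (n * s) ↪ F) :=
    Function.Embedding.nonempty_of_card_le (by rw [Fintype.card_fin]; linarith [mul_comm s n])
  have hx : ∀ a : Fin (n / 2), ∀ i : Fin s,
      nodeEval (n := n) lam ⟨2 * (a : ℕ) + ((0 : Fin 2) : ℕ), by omega⟩ i ≠
        nodeEval (n := n) lam ⟨2 * (a : ℕ) + ((1 : Fin 2) : ℕ), by omega⟩ i := by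
    intro a i he
    have := finProdFinEquiv.injective (lam.injective he)
    simp at this
  choose P hP0 hPd hPe using fun a : Fin (n / 2) =>
    exists_polynomial_fDet_ne_zero
      (fun b => nodeEval (n := n) lam ⟨2 * (a : ℕ) + (b : ℕ), by omega⟩)
      (hx a)
  set G : F[X] := X * (X - C 1) * (X + C ((s : F) - 1)) * (X + C ((s : F) - 2)) with hG
  have hG0 : G ≠ 0 := by
    have := ((monic_X (R := F)).mul (monic_X_sub_C 1)).mul (monic_X_add_C ((s : F) - 1)) |>.mul
      (monic_X_add_C ((s : F) - 2))
    exact this.ne_zero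
  have hGd : G.natDegree ≤ 4 := by
    rw [hG]; compute_degree
  have hne : G * ∏ a, P a ≠ 0 := mul_ne_zero hG0 (Finset.prod_ne_zero_iff.2 fun a _ => hP0 a)
  have hdeg : (G * ∏ a, P a).natDegree < Fintype.card F := by
    refine lt_of_le_of_lt natDegree_mul_le ?_
    have h1 : (∏ a, P a).natDegree ≤ (n / 2) * s := by
      refine (natDegree_prod_le _ _).trans ((Finset.sum_le_sum fun a _ => hPd a).trans ?_)
      simp
    have h2 : 2 * s + (n / 2) * s ≤ n * s := by
      rw [← add_mul]; exact Nat.mul_le_mul_right _ (by omega)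
    have h3 : s * n = n * s := mul_comm _ _
    omega
  obtain ⟨γ, hγ⟩ := exists_eval_ne_zero_of_natDegree_lt_card (G * ∏ a, P a) hne
    (by rw [Cardinal.mk_fintype]; exact_mod_cast hdeg)
  rw [eval_mul, eval_prod] at hγ
  refine ⟨γ, lam, lam.injective, mul_ne_zero ?_ (Finset.prod_ne_zero_iff.2 fun a ha => ?_)⟩
  · have := left_ne_zero_of_mul hγ
    simp only [hG, eval_mul, eval_X, eval_sub, eval_add, eval_C] at this
    rw [gPoly, add_sub_assoc, add_sub_assoc]
    exact this
  · exact hPe a γ (Finset.prod_ne_zero_iff.1 (right_ne_zero_of_mul hγ) a ha)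

/-! ### The MDS property -/

theorem sum_ite_agree_off {ι σ M : Type*} [Fintype ι] [DecidableEq ι] [Fintype σ] [DecidableEq σ]
    [AddCommMonoid M] (a : ι) (u : ι → σ) (f : (ι → σ) → M)
    [∀ v : ι → σ, Decidable (∀ z, z ≠ a → u z = v z)] :
    ∑ v, (if ∀ z, z ≠ a → u z = v z then f v else 0) = ∑ m, f (Function.update u a m) := by
  refine (Finset.sum_filter (fun v : ι → σ => ∀ z, z ≠ a → u z = v z) f).symm.trans ?_
  refine (Finset.sum_nbij' (fun m => Function.update u a m) (fun v => v a) ?_ ?_ ?_ ?_ ?_).symm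
  · intro m _
    rw [Finset.mem_filter]
    exact ⟨Finset.mem_univ _, fun z hz => (Function.update_of_ne hz _ _).symm⟩
  · intro v _; exact Finset.mem_univ _
  · intro m _; exact Function.update_self _ _ _
  · intro v hv
    funext z
    by_cases hz : z = a
    · subst hz; simp
    · rw [Function.update_of_ne hz]; exact (Finset.mem_filter.1 hv).2 z hz
  · intro m _; rfl

theorem blowUp_mulVec {F : Type*} [Field F] {n s : ℕ} (a : Fin ((n + 1) / 2))
    (K : Matrix (Fin s) (Fin s) F) (y : Digits n s → F) (u : Digits n s) :
    (blowUp a K *ᵥ y) u = ∑ m, K (u a) m * y (Function.update u a m) := by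
  simp only [Matrix.mulVec, dotProduct, blowUp, Matrix.of_apply, ite_mul, zero_mul]
  refine (sum_ite_agree_off a u fun v => K (u a) (v a) * y v).trans ?_
  simp

theorem interH_mulVec {F : Type*} [Field F] {n s : ℕ} (r : ℕ) (γ : F) (lam : Fin (n * s) → F)
    (j : Fin n) (y : Digits n s → F) (u : Digits n s) (p : Fin r) :
    (interH r γ lam j *ᵥ y) (u, p) = ∑ m, matV s γ (pos j) (u (grp j)) m *
      nodeEval lam j m ^ (p : ℕ) * y (Function.update u (grp j) m) := by
  simp only [Matrix.mulVec, dotProduct, interH, blowUp, Matrix.of_apply]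
  have : ∀ v : Digits n s, (if ∀ z, z ≠ grp j → u z = v z then
      kernelMatrix r γ (pos j) (nodeEval lam j) (u (grp j)) (v (grp j)) else 0) p * y v =
      if ∀ z, z ≠ grp j → u z = v z then
        kernelMatrix r γ (pos j) (nodeEval lam j) (u (grp j)) (v (grp j)) p * y v else 0 := by
    intro v
    split_ifs <;> simp
  simp only [this]
  refine (sum_ite_agree_off (grp j) u fun v =>
    kernelMatrix r γ (pos j) (nodeEval lam j) (u (grp j)) (v (grp j)) p * y v).trans ?_
  simp [kernelMatrix, powVec]

theorem one_kronecker_mulVec {F κ P Λ : Type*} [Field F] [Fintype κ] [DecidableEq κ] [Fintype Λ]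
    (H : Matrix P Λ F) (y : κ × Λ → F) (b : κ) (w : P) :
    (((1 : Matrix κ κ F) ⊗ₖ H) *ᵥ y) (b, w) = (H *ᵥ fun v => y (b, v)) w := by
  simp only [Matrix.mulVec, dotProduct, Matrix.kroneckerMap_apply, Fintype.sum_prod_type]
  rw [Finset.sum_eq_single b]
  · simp
  · intro b' _ hb
    simp [Matrix.one_apply_ne hb.symm]
  · simp

/-- The parity-check equations, block by block and power by power. -/
theorem mem_code_iff {F : Type*} [Field F] {n s h r : ℕ} {γ : F} {lam : Fin (n * s) → F}
    {c : Fin n → Sym n s h → F} :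
    c ∈ code h r γ lam ↔ ∀ (b : Fin (s + h - 1)) (u : Digits n s), ∀ p < r,
      ∑ j, ∑ m, matV s γ (pos j) (u (grp j)) m * nodeEval lam j m ^ p *
        c j (b, Function.update u (grp j) m) = 0 := by
  have key : ∀ (b : Fin (s + h - 1)) (u : Digits n s) (p : Fin r),
      (∑ j, (parityH h r γ lam j).mulVecLin ∘ₗ LinearMap.proj j :
        (Fin n → Sym n s h → F) →ₗ[F] _) c (b, (u, p)) =
      ∑ j, ∑ m, matV s γ (pos j) (u (grp j)) m * nodeEval lam j m ^ (p : ℕ) *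
        c j (b, Function.update u (grp j) m) := by
    intro b u p
    rw [LinearMap.sum_apply, Finset.sum_apply]
    refine Finset.sum_congr rfl fun j _ => ?_
    simp only [LinearMap.comp_apply, LinearMap.proj_apply, Matrix.mulVecLin_apply, parityH]
    rw [one_kronecker_mulVec, interH_mulVec]
  rw [code, arrayCode, LinearMap.mem_ker]
  constructor
  · intro h0 b u p hp
    rw [← key b u ⟨p, hp⟩, h0]; rfl
  · intro h0
    funext ⟨b, u, p⟩
    rw [key]
    exact h0 b u p p.2

theorem sum_sum_eval_eq_zero {F J σ : Type*} [Field F] [Fintype σ] (T : Finset J)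
    (A x y : J → σ → F) (N : ℕ)
    (h : ∀ p < N, ∑ j ∈ T, ∑ m, A j m * x j m ^ p * y j m = 0) (P : F[X]) (hP : P.degree < N) :
    ∑ j ∈ T, ∑ m, A j m * P.eval (x j m) * y j m = 0 := by
  have := sum_eval_eq_zero_of_sum_pow (T ×ˢ (Finset.univ : Finset σ))
    (fun k => A k.1 k.2 * y k.1 k.2) (fun k => x k.1 k.2) N (fun p hp => ?_) P hP
  · rw [Finset.sum_product] at this
    rw [← this]
    exact Finset.sum_congr rfl fun j _ => Finset.sum_congr rfl fun m _ => by ring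
  · rw [Finset.sum_product, ← h p hp]
    exact Finset.sum_congr rfl fun j _ => Finset.sum_congr rfl fun m _ => by ring

theorem Admissible.parity_independent {F : Type*} [Field F] {n s : ℕ} [NeZero s] {γ : F}
    {lam : Fin (n * s) → F} (h : Admissible γ lam) (T : Finset (Fin n))
    (y : Fin n → Digits n s → F)
    (hy : ∀ u, ∀ p < T.card, ∑ j ∈ T, ∑ m, matV s γ (pos j) (u (grp j)) m *
      nodeEval lam j m ^ p * y j (Function.update u (grp j) m) = 0) :
    ∀ j ∈ T, y j = 0 := by
  refine independent_of_locallyIndependent grp (fun j => matV s γ (pos j)) (nodeEval lam) T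
    (fun a => h.locallyIndependent _ a fun j hj => (Finset.mem_filter.1 hj).2)
    (fun j _ j' _ hg m m' he => hg (by rw [(h.nodeEval_inj he).1])) y fun u P hP => ?_
  exact sum_sum_eval_eq_zero T (fun j m => matV s γ (pos j) (u (grp j)) m) _
    (fun j m => y j (Function.update u (grp j) m)) T.card (hy u) P hP

/-- A codeword supported on at most `r` nodes is zero. -/
theorem Admissible.eq_zero_of_mem_code {F : Type*} [Field F] {n s h r : ℕ} [NeZero s] {γ : F}
    {lam : Fin (n * s) → F} (ha : Admissible γ lam) (T : Finset (Fin n)) (hT : T.card ≤ r)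
    {c : Fin n → Sym n s h → F} (hc : c ∈ code h r γ lam) (h0 : ∀ j ∉ T, c j = 0) : c = 0 := by
  funext j
  by_cases hj : j ∈ T
  · funext ⟨b, u⟩
    refine congrFun (ha.parity_independent T (fun j u => c j (b, u)) (fun u p hp => ?_) j hj) u
    rw [← mem_code_iff.1 hc b u p (hp.trans_le hT)]
    refine Finset.sum_subset (Finset.subset_univ _) fun j _ hj => ?_
    simp [h0 j hj]
  · exact h0 j hj

theorem Admissible.isMDSArrayCode {F : Type*} [Field F] {n s h k : ℕ} [NeZero s] {γ : F}
    {lam : Fin (n * s) → F} (ha : Admissible γ lam) (hk : k ≤ n) :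
    IsMDSArrayCode k (code h (n - k) γ lam) := by
  refine ⟨?_, fun T hT c hc c' hc' he => ?_⟩
  · set L : (Fin n → Sym n s h → F) →ₗ[F] (Fin (s + h - 1) × (Digits n s × Fin (n - k)) → F) :=
      ∑ j, (parityH h (n - k) γ lam j).mulVecLin ∘ₗ LinearMap.proj j with hL
    have hcode : code h (n - k) γ lam = LinearMap.ker L := rfl
    -- the parity-check map `L` is injective on the words supported on the first `n - k` nodes; the
    -- dimensions agree, so that it is surjective, which gives the dimension of its kernel
    set E : (Fin (n - k) → Sym n s h → F) →ₗ[F] (Fin n → Sym n s h → F) :=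
      { toFun := fun y j => if hj : (j : ℕ) < n - k then y ⟨j, hj⟩ else 0
        map_add' := fun y y' => by funext j; by_cases hj : (j : ℕ) < n - k <;> simp [hj]
        map_smul' := fun a y => by funext j; by_cases hj : (j : ℕ) < n - k <;> simp [hj] } with hE
    have hinj : Function.Injective (L ∘ₗ E) := by
      refine (injective_iff_map_eq_zero _).2 fun y hy => ?_
      have hz : E y = 0 := by
        refine ha.eq_zero_of_mem_code (r := n - k) (h := h)
          (Finset.univ.filter fun j : Fin n => (j : ℕ) < n - k) ?_ ?_ fun j hj => ?_
        · rw [Fin.card_filter_val_lt]; exact min_le_right _ _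
        · rw [hcode]; exact hy
        · have : ¬ (j : ℕ) < n - k := by simpa using hj
          simp [hE, this]
      funext i
      have := congrFun hz ⟨i, i.2.trans_le (Nat.sub_le _ _)⟩
      simpa [hE] using this
    have hcards : Module.finrank F (Fin (n - k) → Sym n s h → F) =
        Module.finrank F (Fin (s + h - 1) × (Digits n s × Fin (n - k)) → F) := by
      simp [Module.finrank_pi_fintype]
      ring
    have hsurj : Function.Surjective L := by
      have := (LinearMap.injective_iff_surjective_of_finrank_eq_finrank hcards).1 hinj
      rw [LinearMap.coe_comp] at this
      exact this.of_comp
    have hrank := L.finrank_range_add_finrank_ker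
    rw [LinearMap.range_eq_top.2 hsurj, finrank_top, ← hcards, ← hcode] at hrank
    have h1 : Module.finrank F (Fin (n - k) → Sym n s h → F) =
      (n - k) * Fintype.card (Sym n s h) := by simp [Module.finrank_pi_fintype]
    have h2 : Module.finrank F (Fin n → Sym n s h → F) = n * Fintype.card (Sym n s h) := by
      simp [Module.finrank_pi_fintype]
    rw [h1, h2] at hrank
    have h3 : (n - k) * Fintype.card (Sym n s h) + k * Fintype.card (Sym n s h) =
        n * Fintype.card (Sym n s h) := by rw [← add_mul, Nat.sub_add_cancel hk]
    omega
  · refine sub_eq_zero.1 (ha.eq_zero_of_mem_code Tᶜ ?_ (Submodule.sub_mem _ hc hc') fun j hj => ?_)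
    · rw [Finset.card_compl, Fintype.card_fin, hT]
    · have hj' : j ∈ T := by simpa using hj
      rw [Pi.sub_apply, he j hj', sub_self]

/-! ### The first step of the repair scheme -/

/-- The sum of the blocks `e` and `z + s` of the content `y` of a node. For `z = h - 1` the block
`z + s` does not exist, and the sum is the block `e` alone. -/
def foldBlocks {F : Type*} [Field F] {n s h : ℕ} (z : ℕ) (e : Fin s) (y : Sym n s h → F) :
    Digits n s → F :=
  fun u => ∑ b : Fin (s + h - 1), if (b : ℕ) = e ∨ (b : ℕ) = z + s then y (b, u) else 0

theorem rowSel_mulVec {F : Type*} [Field F] {n s : ℕ} (a : Fin ((n + 1) / 2)) (g : Fin s)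
    (y : Digits n s → F) (u : Digits n s) :
    (rowSel F a g *ᵥ y) (fun z => u z) = y (Function.update u a g) := by
  simp only [Matrix.mulVec, dotProduct, rowSel, Matrix.of_apply]
  rw [Finset.sum_eq_single (Function.update u a g)]
  · rw [if_pos, one_mul]
    exact ⟨Function.update_self _ _ _, fun z => Function.update_of_ne z.2 _ _⟩
  · intro v _ hv
    rw [if_neg, zero_mul]
    rintro ⟨h1, h2⟩
    apply hv
    funext z
    by_cases hz : z = a
    · subst hz; rw [h1, Function.update_self]
    · rw [Function.update_of_ne hz]; exact h2 ⟨z, hz⟩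
  · intro h; exact absurd (Finset.mem_univ _) h

theorem matS_mulVec {F : Type*} [Field F] {n s h : ℕ} (a : Fin ((n + 1) / 2)) (g : Fin s) (z : ℕ)
    (y : Sym n s h → F) (e : Fin s) (u : Digits n s) :
    (matS F h a g z *ᵥ y) (e, fun z => u z) = foldBlocks z e y (Function.update u a (g + e)) := by
  simp only [Matrix.mulVec, dotProduct, matS, Matrix.of_apply, foldBlocks, Fintype.sum_prod_type]
  refine Finset.sum_congr rfl fun b _ => ?_
  split_ifs with hb
  · exact rowSel_mulVec a (g + e) (fun v => y (b, v)) u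
  · simp

theorem repairMatrix_mulVec {F : Type*} [Field F] {n s h : ℕ} [NeZero s] (γ : F)
    (failed : Finset (Fin n)) (i : Fin n) (y : Sym n s h → F) (e : Fin s) (u : Digits n s) :
    (repairMatrix h γ failed i *ᵥ y) (e, fun z => u z) =
      ∑ m, matU s γ (pos i) e m *
        foldBlocks (hat failed i) e y (Function.update u (grp i) m) := by
  -- the product in `repairMatrix` is `Matrix` multiplication only up to unfolding of instances
  have hmul : repairMatrix h γ failed i *ᵥ y = matS F h (grp i) 0 (hat failed i) *ᵥ
      (((1 : Matrix (Fin (s + h - 1)) (Fin (s + h - 1)) F) ⊗ₖ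
        blowUp (grp i) (matU s γ (pos i))) *ᵥ y) := (Matrix.mulVec_mulVec _ _ _).symm
  rw [hmul, matS_mulVec, zero_add]
  simp only [foldBlocks, one_kronecker_mulVec, blowUp_mulVec, Function.update_self,
    Function.update_idem, Finset.mul_sum]
  rw [Finset.sum_comm]
  refine Finset.sum_congr rfl fun b _ => ?_
  split_ifs <;> simp

theorem matD_mulVec_of_eq {F : Type*} [Field F] {n s h : ℕ} [NeZero s] (γ : F)
    (failed : Finset (Fin n)) {i j : Fin n} (hij : grp j = grp i) (y : Sym n s h → F) (e : Fin s)
    (u : Digits n s) : (matD h γ failed i j *ᵥ y) (e, fun z => u z) =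
      foldBlocks (hat failed i) e y (Function.update u (grp i) e) := by
  rw [matD, if_pos hij, matS_mulVec, zero_add]

theorem matD_mulVec_of_ne {F : Type*} [Field F] {n s h : ℕ} [NeZero s] (γ : F)
    (failed : Finset (Fin n)) {i j : Fin n} (hij : grp j ≠ grp i) (y : Sym n s h → F) (e : Fin s)
    (u : Digits n s) : (matD h γ failed i j *ᵥ y) (e, fun z => u z) =
      ∑ m, matU s γ (pos i) e m *
        foldBlocks (hat failed i) e y (Function.update u (grp i) m) := by
  rw [matD, if_neg hij, repairMatrix_mulVec]

/-- Every index in `Row n s a` arises from a digit vector `u`, by taking `u a` as the block index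
and the other digits as they are. -/
theorem row_eq_zero {F : Type*} [Field F] {n s : ℕ} {a : Fin ((n + 1) / 2)} {w : Row n s a → F}
    (hw : ∀ u : Digits n s, w (u a, fun z => u z) = 0) : w = 0 := by
  funext ⟨e, v⟩
  have := hw (fun z => if hz : z = a then e else v ⟨z, hz⟩)
  have hv : (fun z : {z // z ≠ a} =>
      if hz : (z : Fin ((n + 1) / 2)) = a then e else v ⟨z, hz⟩) = v := funext fun z => dif_neg z.2
  rw [hv] at this
  simpa using this

/-- Sums of blocks of a codeword satisfy the parity-check equations of the intermediate code. -/
theorem foldBlocks_parity {F : Type*} [Field F] {n s h r : ℕ} {γ : F} {lam : Fin (n * s) → F}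
    {c : Fin n → Sym n s h → F} (hc : c ∈ code h r γ lam) (z : ℕ) (e : Fin s) (u : Digits n s)
    {p : ℕ} (hp : p < r) :
    ∑ j, ∑ m, matV s γ (pos j) (u (grp j)) m * nodeEval lam j m ^ p *
      foldBlocks z e (c j) (Function.update u (grp j) m) = 0 := by
  have : ∀ b : Fin (s + h - 1), (if (b : ℕ) = e ∨ (b : ℕ) = z + s then
      ∑ j, ∑ m, matV s γ (pos j) (u (grp j)) m * nodeEval lam j m ^ p *
        c j (b, Function.update u (grp j) m) else 0) = 0 := fun b => by
    rw [mem_code_iff.1 hc b u p hp, ite_self]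
  rw [← Finset.sum_eq_zero fun b _ => this b]
  simp only [foldBlocks, Finset.mul_sum]
  rw [Finset.sum_congr rfl fun j _ => Finset.sum_comm, Finset.sum_comm]
  refine Finset.sum_congr rfl fun b _ => ?_
  split_ifs
  · rfl
  · simp

/-- If the failed node `i` receives only zeros from the helper nodes in the first round, then
everything that it has to compute in the first step is zero.

For each `e ∈ [s]`, the parity-check equations of the sum of the blocks `e` and `î + s` are
multiplied by `Φ(U)` on the digit `a` of `i`, and only the rows with digit `e` at `a` are kept.
Together these `s` systems, with `e` in the role of the digit `a`, are the parity-check equations of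
a code with `n - 1 + s` nodes: a node of another group keeps its matrix, the partner of `i` gets the
identity matrix, and `i` is split into `s` virtual nodes with nonzero scalar matrices and cyclically
shifted evaluation points. At most `r` of these nodes are unknown. -/
theorem Admissible.step_one {F : Type*} [Field F] {n s h r : ℕ} [NeZero s] {γ : F}
    {lam : Fin (n * s) → F} (ha : Admissible γ lam) (failed helpers : Finset (Fin n)) {i : Fin n}
    (hi : i ∉ helpers) (hr : n + s ≤ r + helpers.card + 1) {c : Fin n → Sym n s h → F}
    (hc : c ∈ code h r γ lam) (h0 : ∀ j ∈ helpers, matD h γ failed i j *ᵥ c j = 0) :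
    (∀ j, j ≠ i → matD h γ failed i j *ᵥ c j = 0) ∧
      ∀ g, matDdiag F h failed i g *ᵥ c i = 0 := by
  obtain ⟨e, he0, he⟩ := exists_matU_mul_matV_eq_rot ha.gPoly_ne_zero (pos i)
  set a := grp i with hgi
  -- `Sum.inl j` stands for the node `j`, and `Sum.inr g` for the virtual node with content
  -- `C_{i,i}^{⟨g⟩}`; the unknown nodes form `T`
  set T₀ : Finset (Fin n) := Finset.univ.erase i \ helpers with hT₀
  set T : Finset (Fin n ⊕ Fin s) := T₀.disjSum Finset.univ with hT
  set G : Fin n ⊕ Fin s → Fin ((n + 1) / 2) := Sum.elim grp fun _ => a with hG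
  set V : Fin n ⊕ Fin s → Matrix (Fin s) (Fin s) F :=
    Sum.elim (fun j => if grp j = a then 1 else matV s γ (pos j)) (fun g => e g • 1) with hV
  set x : Fin n ⊕ Fin s → Fin s → F :=
    Sum.elim (nodeEval lam) (fun g m => nodeEval lam i (g + m)) with hx
  set f : Fin s → Fin n → Digits n s → F := fun l j => foldBlocks (hat failed i) l (c j) with hf
  set Y : Fin n ⊕ Fin s → Digits n s → F :=
    Sum.elim (fun j u => (matD h γ failed i j *ᵥ c j) (u a, fun z => u z))
      (fun g u => (matDdiag F h failed i g *ᵥ c i) (u a, fun z => u z)) with hY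
  have hTcard : T.card ≤ r := by
    have h1 : helpers ⊆ Finset.univ.erase i := fun j hj =>
      Finset.mem_erase.2 ⟨fun hji => hi (hji ▸ hj), Finset.mem_univ _⟩
    rw [hT, Finset.card_disjSum, hT₀, Finset.card_sdiff_of_subset h1,
      Finset.card_erase_of_mem (Finset.mem_univ _), Finset.card_univ, Finset.card_univ,
      Fintype.card_fin, Fintype.card_fin]
    have := Finset.card_le_card h1
    rw [Finset.card_erase_of_mem (Finset.mem_univ _), Finset.card_univ, Fintype.card_fin] at this
    have := i.2
    omega
  have hne : ∀ j, Sum.inl j ∈ T → j ≠ i := fun j hj => by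
    rw [hT, Finset.inl_mem_disjSum, hT₀] at hj
    exact (Finset.mem_erase.1 (Finset.mem_sdiff.1 hj).1).1
  -- the contribution of a node other than `i` to the combined parity-check equations
  have hterm : ∀ (u : Digits n s) (p : ℕ) (j : Fin n), j ≠ i →
      ∑ l, matU s γ (pos i) (u a) l * ∑ m, matV s γ (pos j) (Function.update u a l (grp j)) m *
        nodeEval lam j m ^ p * f (u a) j (Function.update (Function.update u a l) (grp j) m) =
      ∑ m, V (Sum.inl j) (u (grp j)) m * x (Sum.inl j) m ^ p *
        Y (Sum.inl j) (Function.update u (grp j) m) := by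
    intro u p j hj
    by_cases hja : grp j = a
    · have hpos : pos i ≠ pos j := fun hp => hj (eq_of_grp_eq_of_pos_eq hja hp.symm)
      have hVj : V (Sum.inl j) = 1 := by simp [hV, hja]
      have hYj : ∀ v, Y (Sum.inl j) v = f (v a) j v := fun v => by
        simp only [hY, Sum.elim_inl]
        rw [matD_mulVec_of_eq γ failed hja, ← hgi, Function.update_eq_self]
      rw [hVj, hja]
      simp only [Function.update_self, Function.update_idem, hYj, Finset.mul_sum]
      rw [Finset.sum_comm]
      refine Finset.sum_congr rfl fun m _ => ?_
      have hl : ∑ l, matU s γ (pos i) (u a) l * matV s γ (pos j) l m =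
          (1 : Matrix (Fin s) (Fin s) F) (u a) m := by
        rw [← matU_mul_matV_of_ne ha.gPoly_ne_zero hpos, Matrix.mul_apply]
      trans (∑ l, matU s γ (pos i) (u a) l * matV s γ (pos j) l m) *
        (nodeEval lam j m ^ p * f (u a) j (Function.update u a m))
      · rw [Finset.sum_mul]
        exact Finset.sum_congr rfl fun l _ => by ring
      · rw [hl]
        by_cases hm : u a = m
        · rw [hm]; exact (mul_assoc _ _ _).symm
        · simp [Matrix.one_apply_ne hm]
    · have hVj : V (Sum.inl j) = matV s γ (pos j) := by simp [hV, hja]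
      have hYj : ∀ v, Y (Sum.inl j) v =
          ∑ l, matU s γ (pos i) (v a) l * f (v a) j (Function.update v a l) := fun v => by
        simp only [hY, Sum.elim_inl]
        rw [matD_mulVec_of_ne γ failed hja]
      rw [hVj]
      simp only [hYj, Finset.mul_sum]
      rw [Finset.sum_comm]
      refine Finset.sum_congr rfl fun m _ => Finset.sum_congr rfl fun l _ => ?_
      rw [Function.update_of_ne hja, Function.update_of_ne (Ne.symm hja), Function.update_comm hja]
      simp only [hx, Sum.elim_inl]
      ring
  -- the contribution of `i`, reindexed by `m = g + u a` as that of its virtual nodes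
  have hterm' : ∀ (u : Digits n s) (p : ℕ),
      ∑ l, matU s γ (pos i) (u a) l * ∑ m, matV s γ (pos i) (Function.update u a l (grp i)) m *
        nodeEval lam i m ^ p * f (u a) i (Function.update (Function.update u a l) (grp i) m) =
      ∑ g, ∑ m, V (Sum.inr g) (u a) m * x (Sum.inr g) m ^ p *
        Y (Sum.inr g) (Function.update u a m) := by
    intro u p
    have hYg : ∀ g v, Y (Sum.inr g) v = f (v a) i (Function.update v a (g + v a)) := fun g v => by
      simp only [hY, Sum.elim_inr, matDdiag]
      rw [matS_mulVec]
    have hR : ∀ g, ∑ m, V (Sum.inr g) (u a) m * x (Sum.inr g) m ^ p *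
        Y (Sum.inr g) (Function.update u a m) = rot e (u a) (g + u a) *
          (nodeEval lam i (g + u a) ^ p * f (u a) i (Function.update u a (g + u a))) := by
      intro g
      rw [Finset.sum_eq_single (u a)]
      · simp [hV, hx, hYg, rot, mul_assoc]
      · intro m _ hm
        simp [hV, Matrix.one_apply_ne hm.symm]
      · simp
    simp only [hR]
    refine Eq.trans ?_ (Equiv.sum_comp (Equiv.addRight (u a)) fun m => rot e (u a) m *
      (nodeEval lam i m ^ p * f (u a) i (Function.update u a m))).symm
    simp only [← hgi, Function.update_self, Function.update_idem, Finset.mul_sum]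
    rw [Finset.sum_comm]
    refine Finset.sum_congr rfl fun m _ => ?_
    rw [← he, Matrix.mul_apply, Finset.sum_mul]
    exact Finset.sum_congr rfl fun l _ => by ring
  have hall : ∀ t ∈ T, Y t = 0 := by
    refine independent_of_locallyIndependent G V x T (fun a' => ?_) ?_ Y fun u P hP => ?_
    · by_cases haa : a' = a
      · rw [haa]
        refine locallyIndependent_of_diagonal (Sum.elim (fun _ => 1) e) ?_ ?_ ?_
        · rintro (j | g) _
          · exact one_ne_zero
          · exact he0 g
        · rintro (j | g) hj
          · have : grp j = a := (Finset.mem_filter.1 hj).2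
            simp [hV, this]
          · rfl
        · rintro m (j | g) hj (j' | g') hj' hxx
          · exact congrArg _ (ha.nodeEval_inj hxx).1
          · exact absurd (ha.nodeEval_inj hxx).1 (hne j (Finset.mem_filter.1 hj).1)
          · exact absurd (ha.nodeEval_inj hxx).1.symm (hne j' (Finset.mem_filter.1 hj').1)
          · exact congrArg _ (add_right_cancel (ha.nodeEval_inj hxx).2)
      · have hmap : T.filter (fun t => G t = a') =
            (T₀.filter fun j => grp j = a').map Function.Embedding.inl := by
          ext (j | g)
          · simp [hT, hG]
          · simp [hG, Ne.symm haa]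
        rw [hmap]
        refine (ha.locallyIndependent _ a' fun j hj => (Finset.mem_filter.1 hj).2).map _
          (fun j hj => ?_) fun j _ => rfl
        have : grp j ≠ a := by rw [(Finset.mem_filter.1 hj).2]; exact haa
        simp [hV, this]
    · rintro (j | g) _ (j' | g') _ hgg m m' hxx
      · exact hgg (congrArg grp (ha.nodeEval_inj hxx).1)
      · exact hgg (congrArg grp (ha.nodeEval_inj hxx).1)
      · exact hgg (congrArg grp (ha.nodeEval_inj hxx).1)
      · exact hgg rfl
    · refine sum_sum_eval_eq_zero T (fun t m => V t (u (G t)) m) x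
        (fun t m => Y t (Function.update u (G t) m)) T.card (fun p hp => ?_) P hP
      have hpar : ∑ l, matU s γ (pos i) (u a) l * ∑ j, ∑ m,
          matV s γ (pos j) (Function.update u a l (grp j)) m * nodeEval lam j m ^ p *
            f (u a) j (Function.update (Function.update u a l) (grp j) m) = 0 :=
        Finset.sum_eq_zero fun l _ => by
          rw [foldBlocks_parity hc _ _ _ (hp.trans_le hTcard), mul_zero]
      simp only [Finset.mul_sum (s := Finset.univ (α := Fin n))] at hpar
      rw [Finset.sum_comm, ← Finset.add_sum_erase _ _ (Finset.mem_univ i), hterm' u p,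
        Finset.sum_congr rfl fun j hj => hterm u p j (Finset.mem_erase.1 hj).1] at hpar
      rw [hT, Finset.sum_disjSum, ← hpar, add_comm]
      congr 1
      refine Finset.sum_subset Finset.sdiff_subset fun j hj hj' => ?_
      have hjh : j ∈ helpers := by
        by_contra hjh
        exact hj' (Finset.mem_sdiff.2 ⟨hj, hjh⟩)
      simp [hY, h0 j hjh]
  refine ⟨fun j hj => ?_, fun g => row_eq_zero fun u => congrFun (hall (Sum.inr g) ?_) u⟩
  · by_cases hjh : j ∈ helpers
    · exact h0 j hjh
    · refine row_eq_zero fun u => congrFun (hall (Sum.inl j) ?_) u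
      rw [hT, Finset.inl_mem_disjSum]
      exact Finset.mem_sdiff.2 ⟨Finset.mem_erase.2 ⟨hj, Finset.mem_univ _⟩, hjh⟩
  · rw [hT, Finset.inr_mem_disjSum]; exact Finset.mem_univ _

/-! ### The second step of the repair scheme -/

/-- The block `b` of the content `y` of a node, taken to be zero if `b ≥ s + h - 1`. With this
convention `foldBlocks` is always a sum of two blocks. -/
def blockAt {F : Type*} [Field F] {n s h : ℕ} (y : Sym n s h → F) (b : ℕ) : Digits n s → F :=
  fun u => if hb : b < s + h - 1 then y (⟨b, hb⟩, u) else 0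

theorem foldBlocks_eq_add {F : Type*} [Field F] {n s h : ℕ} (hh : 1 ≤ h) (z : ℕ) (e : Fin s)
    (y : Sym n s h → F) (u : Digits n s) :
    foldBlocks z e y u = blockAt y e u + blockAt y (z + s) u := by
  have he : (e : ℕ) < s + h - 1 := by omega
  have hne : (e : ℕ) ≠ z + s := by omega
  have h1 : ∀ b : Fin (s + h - 1), (if (b : ℕ) = e ∨ (b : ℕ) = z + s then y (b, u) else 0) =
      (if (b : ℕ) = e then y (b, u) else 0) + if (b : ℕ) = z + s then y (b, u) else 0 := by
    intro b
    by_cases h2 : (b : ℕ) = e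
    · have h3 : (b : ℕ) ≠ z + s := h2 ▸ hne
      simp [h2, hne]
    · simp [h2]
  have h2 : ∀ k : ℕ, ∑ b : Fin (s + h - 1), (if (b : ℕ) = k then y (b, u) else 0) =
      blockAt y k u := by
    intro k
    unfold blockAt
    split_ifs with hk
    · rw [Finset.sum_eq_single ⟨k, hk⟩]
      · simp
      · intro b _ hb
        rw [if_neg fun h => hb (Fin.ext h)]
      · simp
    · exact Finset.sum_eq_zero fun b _ => if_neg fun (h : (b : ℕ) = k) => hk (h ▸ b.2)
  unfold foldBlocks
  rw [Finset.sum_congr rfl fun b _ => h1 b, Finset.sum_add_distrib, h2, h2]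

/-- `hat` enumerates the failed nodes by `0, …, h - 1`. -/
theorem exists_hat_eq {n : ℕ} (failed : Finset (Fin n)) {z : ℕ} (hz : z < failed.card) :
    ∃ j ∈ failed, hat failed j = z := by
  have hmaps : ∀ j ∈ failed, hat failed j ∈ Finset.range failed.card := fun j hj => by
    rw [Finset.mem_range]
    exact Finset.card_lt_card (Finset.filter_ssubset.2 ⟨j, hj, lt_irrefl _⟩)
  have hmono : ∀ j ∈ failed, ∀ j' ∈ failed, j < j' → hat failed j < hat failed j' := by
    intro j hj j' hj' hlt
    refine Finset.card_lt_card (Finset.ssubset_iff_of_subset ?_ |>.2 ⟨j, ?_, ?_⟩)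
    · intro m hm
      rw [Finset.mem_filter] at hm ⊢
      exact ⟨hm.1, hm.2.trans hlt⟩
    · exact Finset.mem_filter.2 ⟨hj, hlt⟩
    · simp
  have hinj : Set.InjOn (hat failed) failed := by
    intro j hj j' hj' he
    rcases lt_trichotomy j j' with h | h | h
    · exact absurd he (hmono j hj j' hj' h).ne
    · exact h
    · exact absurd he (hmono j' hj' j hj h).ne'
  have := Finset.surjOn_of_injOn_of_card_le (hat failed) hmaps hinj (by simp)
  obtain ⟨j, hj, he⟩ := this (Finset.mem_coe.2 (Finset.mem_range.2 hz))
  exact ⟨j, hj, he⟩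

/-- The content of a failed node `i` is determined by the data available to it in the second step.
If these vanish, then every block `e < s` is the negative of the block `î + s`, and the blocks
`ĵ + s` agree for all failed nodes `j`. One of the values `ĵ` is `h - 1`, for which this block is
absent, so that all blocks are zero. -/
theorem eq_zero_of_step_two {F : Type*} [Field F] {n s h : ℕ} [NeZero s] {γ : F}
    (hγ : gPoly s γ ≠ 0) (hh : 1 ≤ h) {failed : Finset (Fin n)} (hcard : failed.card = h)
    {i : Fin n} {y : Sym n s h → F} (hdiag : ∀ g, matDdiag F h failed i g *ᵥ y = 0)
    (hoff : ∀ j ∈ failed, j ≠ i → matD h γ failed j i *ᵥ y = 0) : y = 0 := by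
  have h1 : ∀ (e : Fin s) u, blockAt y e u = - blockAt y (hat failed i + s) u := by
    intro e u
    have := congrFun (hdiag (u (grp i) - e)) (e, fun z => u z)
    rw [matDdiag, matS_mulVec, sub_add_cancel, Function.update_eq_self,
      foldBlocks_eq_add hh] at this
    exact eq_neg_of_add_eq_zero_left this
  have h2 : ∀ j ∈ failed, ∀ u, blockAt y (hat failed j + s) u = blockAt y (hat failed i + s) u := by
    intro j hj u
    by_cases hji : j = i
    · rw [hji]
    have h0 := hoff j hj hji
    by_cases hg : grp i = grp j
    · have := congrFun h0 (u (grp j), fun z => u z)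
      rw [matD_mulVec_of_eq γ failed hg, Function.update_eq_self, foldBlocks_eq_add hh, h1] at this
      exact (neg_add_eq_zero.1 this).symm
    · have hz := Matrix.eq_zero_of_mulVec_eq_zero (det_matU_ne_zero hγ (pos j))
        (v := fun m => blockAt y (hat failed j + s) (Function.update u (grp j) m) -
          blockAt y (hat failed i + s) (Function.update u (grp j) m)) (by
          funext e
          have := congrFun h0 (e, fun z => u z)
          rw [matD_mulVec_of_ne γ failed hg] at this
          simp only [foldBlocks_eq_add hh, h1] at this
          simp only [Matrix.mulVec, dotProduct]
          refine Eq.trans (Finset.sum_congr rfl fun m _ => ?_) this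
          ring)
      have := congrFun hz (u (grp j))
      simp only [Function.update_eq_self, Pi.zero_apply] at this
      exact sub_eq_zero.1 this
  have h3 : ∀ u, blockAt y (hat failed i + s) u = 0 := by
    intro u
    obtain ⟨j, hj, he⟩ := exists_hat_eq failed (z := h - 1) (by omega)
    rw [← h2 j hj u, he]
    exact dif_neg (by omega)
  have h4 : ∀ b < s + h - 1, ∀ u, blockAt y b u = 0 := by
    intro b hb u
    by_cases hbs : b < s
    · rw [h1 ⟨b, hbs⟩ u, h3, neg_zero]
    · obtain ⟨j, hj, he⟩ := exists_hat_eq failed (z := b - s) (by omega)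
      have := h2 j hj u
      rwa [he, Nat.sub_add_cancel (not_lt.1 hbs), h3] at this
  funext ⟨b, u⟩
  have := h4 b b.2 u
  simpa [blockAt] using this

theorem card_Row {n s : ℕ} (a : Fin ((n + 1) / 2)) :
    Fintype.card (Row n s a) = s ^ ((n + 1) / 2) := by
  have : 0 < (n + 1) / 2 := a.pos
  simp only [Fintype.card_prod, Fintype.card_fin, Fintype.card_fun, Fintype.card_subtype_compl,
    Fintype.card_subtype_eq]
  rw [← pow_succ', Nat.sub_add_cancel this]

theorem bandwidth_twoStepScheme {F : Type*} [Field F] {n s : ℕ} [NeZero s] (h : ℕ) (γ : F)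
    (failed helpers : Finset (Fin n))
    (solve : (i : failed) → (helpers → Row n s (grp i.1) → F) → Intermediate F s failed i)
    (combine : (i : failed) → (Fin s → Row n s (grp i.1) → F) →
      ((j : {j : failed // j ≠ i}) → Row n s (grp j.1.1) → F) → (Sym n s h → F)) :
    (twoStepScheme h γ failed helpers solve combine).bandwidth =
      failed.card * (helpers.card + (failed.card - 1)) * s ^ ((n + 1) / 2) := by
  have h1 : ∀ (i : failed) (j : helpers),
      @Fintype.card ((twoStepScheme h γ failed helpers solve combine).Idx₁ i j)
        ((twoStepScheme h γ failed helpers solve combine).fin₁ i j) = s ^ ((n + 1) / 2) :=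
    fun i j => card_Row (grp i.1)
  have h2 : ∀ (i : failed) (j : {j : failed // j ≠ i}),
      @Fintype.card ((twoStepScheme h γ failed helpers solve combine).Idx₂ i j)
        ((twoStepScheme h γ failed helpers solve combine).fin₂ i j) = s ^ ((n + 1) / 2) :=
    fun i j => card_Row (grp j.1.1)
  simp only [RepairScheme.bandwidth, h1, h2, Finset.sum_const, Finset.card_univ,
    Fintype.card_coe, Fintype.card_subtype_compl, Fintype.card_subtype_eq, smul_eq_mul]
  ring

theorem natCeil_half (n : ℕ) : ⌈(n : ℚ) / 2⌉₊ = (n + 1) / 2 := by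
  apply le_antisymm
  · rw [Nat.ceil_le, div_le_iff₀ (by norm_num)]
    exact_mod_cast (by omega : n ≤ (n + 1) / 2 * 2)
  · have := Nat.le_ceil ((n : ℚ) / 2)
    rw [div_le_iff₀ (by norm_num)] at this
    have h2 : n ≤ ⌈(n : ℚ) / 2⌉₊ * 2 := by exact_mod_cast this
    omega

theorem card_Sym (n s h : ℕ) :
    Fintype.card (Sym n s h) = (s + h - 1) * s ^ ((n + 1) / 2) := by simp

/-- The computations in both steps of the two-step scheme are possible: by linearity, the required
vectors are functions of the available data as soon as they vanish whenever the data do. -/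
theorem Admissible.exists_solve_combine {F : Type*} [Field F] {n s h r : ℕ} [NeZero s] {γ : F}
    {lam : Fin (n * s) → F} (ha : Admissible γ lam) (hh : 1 ≤ h) {failed helpers : Finset (Fin n)}
    (hcard : failed.card = h) (hdisj : Disjoint failed helpers)
    (hr : n + s ≤ r + helpers.card + 1) :
    ∃ solve combine,
      (∀ c ∈ code h r γ lam, ∀ i : failed,
        solve i (fun j : helpers => matD h γ failed i.1 j.1 *ᵥ c j.1) =
          intermediate h γ failed c i) ∧
      (twoStepScheme h γ failed helpers solve combine).Repairs (code h r γ lam) := by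
  classical
  set obs : (i : failed) → (Fin n → Sym n s h → F) → (helpers → Row n s (grp i.1) → F) :=
    fun i c j => matD h γ failed i.1 j.1 *ᵥ c j.1 with hobs
  set dat : (i : failed) → (Sym n s h → F) → (Fin s → Row n s (grp i.1) → F) ×
      ((j : {j : failed // j ≠ i}) → Row n s (grp j.1.1) → F) :=
    fun i y => (fun g => matDdiag F h failed i.1 g *ᵥ y, fun j => matD h γ failed j.1.1 i.1 *ᵥ y)
    with hdat
  have hsolve : ∀ i : failed, Function.FactorsThrough
      (fun c : code h r γ lam => intermediate h γ failed c.1 i)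
      (fun c : code h r γ lam => obs i c.1) := by
    intro i c c' he
    have h1 := ha.step_one failed helpers (Finset.disjoint_left.1 hdisj i.2) hr
      (Submodule.sub_mem _ c.2 c'.2) (fun j hj => by
        have := congrFun he ⟨j, hj⟩
        simp only [hobs] at this
        rw [Pi.sub_apply, Matrix.mulVec_sub, this, sub_self])
    refine Prod.ext (funext fun g => ?_) (funext fun j => ?_)
    · have := h1.2 g
      rw [Pi.sub_apply, Matrix.mulVec_sub] at this
      exact sub_eq_zero.1 this
    · have := h1.1 j.1.1 fun hji => j.2 (Subtype.ext hji)
      rw [Pi.sub_apply, Matrix.mulVec_sub] at this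
      exact sub_eq_zero.1 this
  have hcombine : ∀ i : failed, Function.Injective (dat i) := by
    intro i y y' he
    refine sub_eq_zero.1 (eq_zero_of_step_two ha.gPoly_ne_zero hh hcard (i := i.1)
      (fun g => ?_) fun j hj hji => ?_)
    · have := congrFun (congrArg Prod.fst he) g
      simp only [hdat] at this
      rw [Matrix.mulVec_sub, this, sub_self]
    · have := congrFun (congrArg Prod.snd he) ⟨⟨j, hj⟩, fun h' => hji (congrArg Subtype.val h')⟩
      simp only [hdat] at this
      rw [Matrix.mulVec_sub, this, sub_self]
  set solve : (i : failed) → (helpers → Row n s (grp i.1) → F) → Intermediate F s failed i :=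
    fun i => Function.extend (fun c : code h r γ lam => obs i c.1)
      (fun c : code h r γ lam => intermediate h γ failed c.1 i) 0 with hsolve_def
  have hs : ∀ c ∈ code h r γ lam, ∀ i : failed,
      solve i (fun j : helpers => matD h γ failed i.1 j.1 *ᵥ c j.1) =
        intermediate h γ failed c i :=
    fun c hc i => (hsolve i).extend_apply 0 ⟨c, hc⟩
  refine ⟨solve, fun i w₁ w₂ => Function.extend (dat i) id 0 (w₁, w₂), hs, fun c hc i => ?_⟩
  have h2 : Function.extend (dat i) id 0 (dat i (c i.1)) = c i.1 := (hcombine i).extend_apply id 0 _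
  refine Eq.trans (congrArg (Function.extend (dat i) id 0) (Prod.ext ?_ (funext fun j => ?_))) h2
  · have hi := congrArg Prod.fst (hs c hc i)
    exact hi
  · have hj := congrFun (congrArg Prod.snd (hs c hc j.1)) ⟨i, j.2.symm⟩
    exact hj

end CoopMSR

theorem mainTheorem1 {F : Type*} [Field F] [Fintype F] (n k d h : ℕ)
    (hk : 1 ≤ k) (hh : 1 ≤ h) (hkd : k + 1 ≤ d) (hdn : d + h ≤ n)
    (hq : (d - k + 1) * n + 1 ≤ Fintype.card F) :
    (∃ (γ : F) (lam : Fin (n * (d - k + 1)) → F), CoopMSR.Admissible γ lam) ∧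
    ∀ (γ : F) (lam : Fin (n * (d - k + 1)) → F), CoopMSR.Admissible γ lam →
      Fintype.card (CoopMSR.Sym n (d - k + 1) h) =
        (d - k + h) * (d - k + 1) ^ ⌈(n : ℚ) / 2⌉₊ ∧
      CoopMSR.IsCooperativeMSR k h d (CoopMSR.code h (n - k) γ lam) ∧
      ∀ failed helpers : Finset (Fin n), failed.card = h → helpers.card = d →
        Disjoint failed helpers →
        ∃ solve combine,
          (∀ c ∈ CoopMSR.code h (n - k) γ lam, ∀ i : failed,
            solve i (fun j : helpers => (CoopMSR.matD h γ failed i.1 j.1).mulVec (c j.1)) =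
              CoopMSR.intermediate h γ failed c i) ∧
          (CoopMSR.twoStepScheme h γ failed helpers solve combine).Repairs
            (CoopMSR.code h (n - k) γ lam) ∧
          ((CoopMSR.twoStepScheme h γ failed helpers solve combine).bandwidth : ℚ) =
            CoopMSR.optimalBandwidth k d h (Fintype.card (CoopMSR.Sym n (d - k + 1) h)) := by
  refine ⟨CoopMSR.exists_admissible (by omega) (by omega) hq, fun γ lam ha => ?_⟩
  have hscheme : ∀ failed helpers : Finset (Fin n), failed.card = h → helpers.card = d →
        Disjoint failed helpers →
        ∃ solve combine,
          (∀ c ∈ CoopMSR.code h (n - k) γ lam, ∀ i : failed,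
            solve i (fun j : helpers => (CoopMSR.matD h γ failed i.1 j.1).mulVec (c j.1)) =
              CoopMSR.intermediate h γ failed c i) ∧
          (CoopMSR.twoStepScheme h γ failed helpers solve combine).Repairs
            (CoopMSR.code h (n - k) γ lam) ∧
          ((CoopMSR.twoStepScheme h γ failed helpers solve combine).bandwidth : ℚ) =
            CoopMSR.optimalBandwidth k d h (Fintype.card (CoopMSR.Sym n (d - k + 1) h)) := by
    intro failed helpers hf hd hdisj
    obtain ⟨solve, combine, h1, h2⟩ :=
      ha.exists_solve_combine (r := n - k) hh hf hdisj (by omega)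
    refine ⟨solve, combine, h1, h2, ?_⟩
    rw [CoopMSR.bandwidth_twoStepScheme, CoopMSR.card_Sym, hf, hd, CoopMSR.optimalBandwidth]
    obtain ⟨e, rfl⟩ : ∃ e, d = k + e := ⟨d - k, by omega⟩
    obtain ⟨g, rfl⟩ : ∃ g, h = g + 1 := ⟨h - 1, by omega⟩
    rw [show k + e - k + 1 + (g + 1) - 1 = e + g + 1 by omega]
    push_cast [Nat.add_sub_cancel]
    rw [show (k : ℚ) + e - k + (g + 1) = e + g + 1 by ring]
    have : (e : ℚ) + g + 1 ≠ 0 := by positivity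
    field_simp
    ring
  refine ⟨?_, ⟨ha.isMDSArrayCode (by omega), fun failed helpers hf hd hdisj => ?_⟩, hscheme⟩
  · rw [CoopMSR.card_Sym, CoopMSR.natCeil_half]
    congr 1
    omega
  · obtain ⟨solve, combine, _, h2, h3⟩ := hscheme failed helpers hf hd hdisj
    exact ⟨_, h2, h3⟩
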